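/- Let $Q$ be an $n$-dimensional smooth Riemannian manifold with metric $\langle\cdot,\cdot\rangle$, Levi-Civita connection $\nabla$, covariant derivative $D/dt$ along curves, and curvature $R(X,Y)Z=\nabla_X\nabla_YZ-\nabla_Y\nabla_XZ-\nabla_{[X,Y]}Z$. Let $\mu^1,\dots,\mu^m$ be smooth 1-forms on $Q$, $V:Q\to\mathbb R$ a smooth potential, $\sigma\ge 0$ and $T>0$. Let $X_a$ be the vector field with $\langle X_a,Y\rangle=\mu^a(Y)$ for all $Y$, and let $S_a:TQ\to TQ$ be the bundle map with $\langle S_a(X),Y\rangle=d\mu^a(X,Y)=X(\mu^a(Y))-Y(\mu^a(X))-\mu^a([X,Y])$. For $v_0\in T_{q_0}Q$ and $v_T\in T_{q_T}Q$, let $\Omega$ be the set of $C^1$, piecewise $C^\infty$ curves $c:[0,T]\to Q$ with $c(0)=q_0$, $c(T)=q_T$, $\dot c(0)=v_0$, $\dot c(T)=v_T$. Consider the problem of minimizing $$\int_0^T \tfrac12\Big(\Big\langle \tfrac{D^2c}{dt^2},\tfrac{D^2c}{dt^2}\Big\rangle+\sigma\|\dot c\|^2+V(c(t))\Big)\,dt$$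 over the curves $c\in\Omega$ that satisfy the constraints $\mu^a\big(\tfrac{D^2c}{dt^2}\big)=0$, $a=1,\dots,m$ (at all but finitely many $t$). A curve $c\in\Omega$ satisfying the constraints is called a normal extremal, with multipliers $\lambda_1,\dots,\lambda_m$ (continuous, piecewise $C^\infty$ functions on $[0,T]$), if $(c,\lambda)$ is a critical point of $$\mathcal J(c,\lambda)=\int_0^T\Big[\tfrac12\Big(\Big\langle \tfrac{D^2c}{dt^2},\tfrac{D^2c}{dt^2}\Big\rangle+\sigma\|\dot c\|^2+V(c)\Big)+\sum_a\lambda_a\,\mu^a\Big(\tfrac{D^2c}{dt^2}\Big)\Big]dt,$$ that is, $\frac{d}{ds}\big|_{s=0}\mathcal J(c_s,\lambda_s)=0$ for all variations $(c_s,\lambda_s)$, $|s|<\varepsilon$, of $(c,\lambda)$ with $c_s\in\Omega$ that are $C^\infty$ in $(s,t)$ on each strip $(-\varepsilon,\varepsilon)\times[t_{i-1},t_i]$ of some finite subdivision $0=t_0<\dots<t_N=T$ of $[0,T]$. If $c$ is a normal extremal with multipliers $\lambda_a$, then at every $t\in[0,T]$ other than the finitely many break points of $(c,\lambda)$ (so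 on all of $[0,T]$ if $c$ and $\lambda$ are smooth, with one-sided derivatives at the end points) $$\frac{D^4c}{dt^4}+R\Big(\frac{D^2c}{dt^2},\dot c\Big)\dot c-\sigma\frac{D^2c}{dt^2}+\sum_a\Big[\ddot\lambda_aX_a+2\dot\lambda_a\frac{DX_a}{dt}+\lambda_a\frac{D^2X_a}{dt^2}+\lambda_a\Big(R(X_a,\dot c)\dot c+\nabla_{\frac{D^2c}{dt^2}}X_a-S_a\Big(\frac{D^2c}{dt^2}\Big)\Big)\Big]+\frac12\,\mathrm{grad}\,V=0,$$ where $X_a$ and $\mathrm{grad}\,V$ are evaluated along $c$, and $\mathrm{grad}\,V$ is defined by $dV(Z)=\langle\mathrm{grad}\,V,Z\rangle$. -/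

import Mathlib

open Set Bundle MeasureTheory
open scoped Manifold ContDiff Topology

noncomputable section

namespace ConstrainedAcceleration

variable {n m : ℕ} {Q : Type*} [TopologicalSpace Q] [ChartedSpace (EuclideanSpace ℝ (Fin n)) Q]
  [IsManifold (𝓡 n) ∞ Q]

/-- Smooth Riemannian metrics on the `n`-dimensional manifold `Q`. -/
abbrev Metric (n : ℕ) (Q : Type*) [TopologicalSpace Q]
    [ChartedSpace (EuclideanSpace ℝ (Fin n)) Q] [IsManifold (𝓡 n) ∞ Q] :=
  ContMDiffRiemannianMetric (𝓡 n) ∞ (EuclideanSpace ℝ (Fin n))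
    (fun q : Q ↦ TangentSpace (𝓡 n) q)

/-- Vector fields on `Q` (not necessarily smooth). -/
abbrev VField (n : ℕ) (Q : Type*) [TopologicalSpace Q]
    [ChartedSpace (EuclideanSpace ℝ (Fin n)) Q] :=
  (q : Q) → TangentSpace (𝓡 n) q

/-- 1-forms on `Q` (not necessarily smooth). -/
abbrev OneForm (n : ℕ) (Q : Type*) [TopologicalSpace Q]
    [ChartedSpace (EuclideanSpace ℝ (Fin n)) Q] :=
  (q : Q) → TangentSpace (𝓡 n) q →L[ℝ] ℝ

/-- A 1-form is smooth when it is a smooth section of the cotangent bundle. -/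
def OneForm.IsSmooth (μ : OneForm n Q) : Prop :=
  ContMDiff (𝓡 n) ((𝓡 n).prod 𝓘(ℝ, EuclideanSpace ℝ (Fin n) →L[ℝ] ℝ)) ∞
    (fun q ↦ (⟨q, μ q⟩ : TotalSpace (EuclideanSpace ℝ (Fin n) →L[ℝ] ℝ)
      (fun q : Q ↦ TangentSpace (𝓡 n) q →L[ℝ] Bundle.Trivial Q ℝ q)))

/-! ### Musical isomorphism and gradient -/

/-- The musical isomorphism `♯ : T*_q Q → T_q Q`, the inverse of `v ↦ ⟨v, ·⟩`. -/
def sharp (g : Metric n Q) (q : Q) (α : TangentSpace (𝓡 n) q →L[ℝ] ℝ) : TangentSpace (𝓡 n) q :=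
  (g.inner q).inverse α

/-- The defining property `⟨♯α, w⟩ = α(w)`. -/
theorem inner_sharp (g : Metric n Q) (q : Q) (α : TangentSpace (𝓡 n) q →L[ℝ] ℝ)
    (w : TangentSpace (𝓡 n) q) : g.inner q (sharp g q α) w = α w := by
  let B : EuclideanSpace ℝ (Fin n) →L[ℝ] EuclideanSpace ℝ (Fin n) →L[ℝ] ℝ := g.inner q
  have hinj : Function.Injective B.toLinearMap := by
    rw [← LinearMap.ker_eq_bot, LinearMap.ker_eq_bot']
    intro v hv
    by_contra hne
    have h1 : 0 < B v v := g.pos q v hne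
    have h2 : B v = 0 := hv
    rw [h2] at h1
    simp at h1
  have hdim : Module.finrank ℝ (EuclideanSpace ℝ (Fin n)) =
      Module.finrank ℝ (EuclideanSpace ℝ (Fin n) →L[ℝ] ℝ) := by
    rw [← (LinearMap.toContinuousLinearMap
      (𝕜 := ℝ) (E := EuclideanSpace ℝ (Fin n)) (F' := ℝ)).finrank_eq]
    exact (Subspace.dual_finrank_eq (K := ℝ) (V := EuclideanSpace ℝ (Fin n))).symm
  let e : EuclideanSpace ℝ (Fin n) ≃L[ℝ] (EuclideanSpace ℝ (Fin n) →L[ℝ] ℝ) :=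
    (LinearEquiv.ofInjectiveOfFinrankEq B.toLinearMap hinj hdim).toContinuousLinearEquiv
  have he : (e : EuclideanSpace ℝ (Fin n) →L[ℝ] EuclideanSpace ℝ (Fin n) →L[ℝ] ℝ) = B := by
    ext v w
    rfl
  have key : ∀ β, B (B.inverse β) = β := by
    intro β
    rw [← he, ContinuousLinearMap.inverse_equiv]
    exact e.apply_symm_apply β
  exact congrArg (fun β : EuclideanSpace ℝ (Fin n) →L[ℝ] ℝ ↦ β w) (key α)

/-- The vector field `X` with `⟨μ, Y⟩ = ⟨X, Y⟩` for all `Y`, i.e. `♭(X) = μ`. -/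
def dualField (g : Metric n Q) (μ : OneForm n Q) : VField n Q := fun q ↦ sharp g q (μ q)

/-- The gradient: `dV(q)(Z) = ⟨grad V(q), Z⟩`. -/
def grad (g : Metric n Q) (V : Q → ℝ) : VField n Q :=
  fun q ↦ sharp g q (mfderiv (𝓡 n) 𝓘(ℝ, ℝ) V q)

/-! ### Objects in local coordinates

`x₀ : Q` selects the chart `extChartAt (𝓡 n) x₀` around `x₀`. -/

/-- The components in the chart at `x₀` of a tangent vector at `q`. -/
def toCoord (x₀ q : Q) : TangentSpace (𝓡 n) q →L[ℝ] EuclideanSpace ℝ (Fin n) :=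
  mfderiv (𝓡 n) 𝓘(ℝ, EuclideanSpace ℝ (Fin n)) (extChartAt (𝓡 n) x₀) q

/-- The tangent vector at the point with coordinates `y`, given by its components in the chart
at `x₀`. -/
def ofCoord (x₀ : Q) (y : EuclideanSpace ℝ (Fin n)) :
    EuclideanSpace ℝ (Fin n) →L[ℝ] TangentSpace (𝓡 n) ((extChartAt (𝓡 n) x₀).symm y) :=
  mfderiv 𝓘(ℝ, EuclideanSpace ℝ (Fin n)) (𝓡 n) (extChartAt (𝓡 n) x₀).symm y

/-- The tangent vector at `q` whose components in the chart at `q` are given. -/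
def fromCoordAt (q : Q) : EuclideanSpace ℝ (Fin n) →L[ℝ] TangentSpace (𝓡 n) q :=
  (toCoord q q).inverse

/-- The components `g_ij` of the metric in the chart at `x₀`, as a bilinear form. -/
def metricCoord (g : Metric n Q) (x₀ : Q) (y : EuclideanSpace ℝ (Fin n)) :
    EuclideanSpace ℝ (Fin n) →L[ℝ] EuclideanSpace ℝ (Fin n) →L[ℝ] ℝ :=
  let G : EuclideanSpace ℝ (Fin n) →L[ℝ] EuclideanSpace ℝ (Fin n) →L[ℝ] ℝ :=
    g.inner ((extChartAt (𝓡 n) x₀).symm y)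
  let L : EuclideanSpace ℝ (Fin n) →L[ℝ] EuclideanSpace ℝ (Fin n) := ofCoord x₀ y
  G.bilinearComp L L

/-- The Christoffel symbols of the Levi-Civita connection in the chart at `x₀`:
`g(Γ(u, v), w) = ½ (∂_u g(v, w) + ∂_v g(u, w) - ∂_w g(u, v))`, so that
`Γ(u, v)^k = Γ^k_ij u^i v^j`. -/
def christoffel (g : Metric n Q) (x₀ : Q) (y u v : EuclideanSpace ℝ (Fin n)) :
    EuclideanSpace ℝ (Fin n) :=
  (metricCoord g x₀ y).inverse
    ((1 / 2 : ℝ) • (fderiv ℝ (metricCoord g x₀) y u v + fderiv ℝ (metricCoord g x₀) y v u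
      - ((fderiv ℝ (metricCoord g x₀) y).flip u).flip v))

/-- The components of a 1-form in the chart at `x₀`. -/
def formCoord (μ : OneForm n Q) (x₀ : Q) (y : EuclideanSpace ℝ (Fin n)) :
    EuclideanSpace ℝ (Fin n) →L[ℝ] ℝ :=
  (μ ((extChartAt (𝓡 n) x₀).symm y)).comp (ofCoord x₀ y)

/-- The components of a vector field in the chart at `x₀`. -/
def fieldCoord (X : VField n Q) (x₀ : Q) (y : EuclideanSpace ℝ (Fin n)) :
    EuclideanSpace ℝ (Fin n) :=
  toCoord x₀ ((extChartAt (𝓡 n) x₀).symm y) (X ((extChartAt (𝓡 n) x₀).symm y))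

/-! ### Tensors and derivatives of fields

Each value at `q` is computed in the chart at `q`; it does not depend on the chart. -/

/-- The Levi-Civita covariant derivative `∇_u X` at `q`:
`(∇_u X)^k = u^i ∂_i X^k + Γ^k_ij u^i X^j`. -/
def nabla (g : Metric n Q) (X : VField n Q) (q : Q) (u : TangentSpace (𝓡 n) q) :
    TangentSpace (𝓡 n) q :=
  let y := extChartAt (𝓡 n) q q
  fromCoordAt q (fderiv ℝ (fieldCoord X q) y (toCoord q q u)
    + christoffel g q y (toCoord q q u) (fieldCoord X q y))

/-- The curvature tensor `R(u, v)w = ∇_u ∇_v w - ∇_v ∇_u w - ∇_[u,v] w` at `q`, in coordinates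
`∂_u Γ(v, w) - ∂_v Γ(u, w) + Γ(u, Γ(v, w)) - Γ(v, Γ(u, w))`. -/
def curvature (g : Metric n Q) (q : Q) (u v w : TangentSpace (𝓡 n) q) : TangentSpace (𝓡 n) q :=
  let y := extChartAt (𝓡 n) q q
  let a := toCoord q q u
  let b := toCoord q q v
  let z := toCoord q q w
  fromCoordAt q (fderiv ℝ (fun y' ↦ christoffel g q y' b z) y a
    - fderiv ℝ (fun y' ↦ christoffel g q y' a z) y b
    + christoffel g q y a (christoffel g q y b z)
    - christoffel g q y b (christoffel g q y a z))

/-- `dμ(u, ·)` at `q`, where `dμ(U, W) = U(μ(W)) - W(μ(U)) - μ([U, W])`, in coordinates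
`dμ(u, w) = ∂_u μ(w) - ∂_w μ(u)`. -/
def dForm (μ : OneForm n Q) (q : Q) (u : TangentSpace (𝓡 n) q) : TangentSpace (𝓡 n) q →L[ℝ] ℝ :=
  let y := extChartAt (𝓡 n) q q
  (fderiv ℝ (formCoord μ q) y (toCoord q q u)
    - (fderiv ℝ (formCoord μ q) y).flip (toCoord q q u)).comp (toCoord q q)

/-- The bundle map `S : TQ → TQ` with `dμ(u, w) = ⟨S(u), w⟩`. -/
def opS (g : Metric n Q) (μ : OneForm n Q) (q : Q) (u : TangentSpace (𝓡 n) q) :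
    TangentSpace (𝓡 n) q :=
  sharp g q (dForm μ q u)

/-! ### Calculus along curves

Only the restriction of a curve `c : ℝ → Q` to `[0, T]` plays a role: all derivatives are taken
within `[0, T]`, so they are one-sided at the end points. -/

/-- The velocity `ċ(t)`. -/
def velocity (n : ℕ) {Q : Type*} [TopologicalSpace Q] [ChartedSpace (EuclideanSpace ℝ (Fin n)) Q]
    (T : ℝ) (c : ℝ → Q) (t : ℝ) : TangentSpace (𝓡 n) (c t) :=
  mfderivWithin 𝓘(ℝ, ℝ) (𝓡 n) c (Icc 0 T) t (1 : ℝ)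

/-- The covariant derivative `DW/dt` of a vector field `W` along `c`, computed in the chart at
`c(t)`: `(DW/dt)^k = Ẇ^k + Γ^k_ij ċ^i W^j`. -/
def covD (g : Metric n Q) (T : ℝ) (c : ℝ → Q) (W : (t : ℝ) → TangentSpace (𝓡 n) (c t)) (t : ℝ) :
    TangentSpace (𝓡 n) (c t) :=
  fromCoordAt (c t) (derivWithin (fun τ ↦ toCoord (c t) (c τ) (W τ)) (Icc 0 T) t
    + christoffel g (c t) (extChartAt (𝓡 n) (c t) (c t))
        (toCoord (c t) (c t) (velocity n T c t)) (toCoord (c t) (c t) (W t)))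

/-- The covariant acceleration `D²c/dt²`. -/
def accel (g : Metric n Q) (T : ℝ) (c : ℝ → Q) : (t : ℝ) → TangentSpace (𝓡 n) (c t) :=
  covD g T c (velocity n T c)

/-- The curve `c : [0, T] → Q` is smooth on each closed piece into which the finitely many points
of `P` divide `[0, T]`. -/
def SmoothOffCurve (n : ℕ) {Q : Type*} [TopologicalSpace Q]
    [ChartedSpace (EuclideanSpace ℝ (Fin n)) Q] (T : ℝ) (P : Finset ℝ) (c : ℝ → Q) : Prop :=
  ∀ a b : ℝ, 0 ≤ a → a < b → b ≤ T → (∀ p ∈ P, p ∉ Ioo a b) →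
    ContMDiffOn 𝓘(ℝ, ℝ) (𝓡 n) ∞ c (Icc a b)

/-- The same for the real-valued functions `lam a`, `a = 1, …, m`. -/
def SmoothOffFun (T : ℝ) (P : Finset ℝ) (lam : Fin m → ℝ → ℝ) : Prop :=
  ∀ a b : ℝ, 0 ≤ a → a < b → b ≤ T → (∀ p ∈ P, p ∉ Ioo a b) →
    ∀ i, ContDiffOn ℝ ∞ (lam i) (Icc a b)

/-- `c` belongs to the space `Ω` of `C¹`, piecewise smooth curves `[0, T] → Q` with
`(c(0), ċ(0)) = ξ₀` and `(c(T), ċ(T)) = ξT`, and is smooth off `P`. -/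
structure MemOmega (T : ℝ) (ξ₀ ξT : TangentBundle (𝓡 n) Q) (P : Finset ℝ) (c : ℝ → Q) : Prop where
  contMDiffOn : ContMDiffOn 𝓘(ℝ, ℝ) (𝓡 n) 1 c (Icc 0 T)
  smoothOff : SmoothOffCurve n T P c
  left : (⟨c 0, velocity n T c 0⟩ : TangentBundle (𝓡 n) Q) = ξ₀
  right : (⟨c T, velocity n T c T⟩ : TangentBundle (𝓡 n) Q) = ξT

/-! ### The variational problem -/

/-- The augmented functional
`𝓙(c, λ) = ∫₀ᵀ ½ (⟨D²c/dt², D²c/dt²⟩ + σ ‖ċ‖² + V(c)) + λ_a ⟨μ^a(c), D²c/dt²⟩ dt`. -/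
def augmentedFunctional (g : Metric n Q) (μ : Fin m → OneForm n Q) (V : Q → ℝ) (σ T : ℝ)
    (c : ℝ → Q) (lam : Fin m → ℝ → ℝ) : ℝ :=
  ∫ t in (0 : ℝ)..T,
    ((1 / 2 : ℝ) * (g.inner (c t) (accel g T c t) (accel g T c t)
        + σ * g.inner (c t) (velocity n T c t) (velocity n T c t) + V (c t))
      + ∑ a, lam a t * μ a (c t) (accel g T c t))

/-- `(s, t) ↦ (α s t, Λ s · t)`, `|s| < ε`, is a variation of `(c, lam)`: every `α s` lies in `Ω`,
and after dividing `[0, T]` at finitely many points, `α` and `Λ` are smooth in `(s, t)` on each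
strip. -/
structure IsVariation (T : ℝ) (ξ₀ ξT : TangentBundle (𝓡 n) Q) (c : ℝ → Q) (lam : Fin m → ℝ → ℝ)
    (ε : ℝ) (P : Finset ℝ) (α : ℝ → ℝ → Q) (Λ : ℝ → Fin m → ℝ → ℝ) : Prop where
  pos : 0 < ε
  curve_zero : ∀ t ∈ Icc 0 T, α 0 t = c t
  mult_zero : ∀ a, ∀ t ∈ Icc 0 T, Λ 0 a t = lam a t
  memOmega : ∀ s ∈ Ioo (-ε) ε, MemOmega T ξ₀ ξT P (α s)
  curve_smooth : ∀ a b : ℝ, 0 ≤ a → a < b → b ≤ T → (∀ p ∈ P, p ∉ Ioo a b) →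
    ContMDiffOn 𝓘(ℝ, ℝ × ℝ) (𝓡 n) ∞ (fun p : ℝ × ℝ ↦ α p.1 p.2) (Ioo (-ε) ε ×ˢ Icc a b)
  mult_smooth : ∀ a b : ℝ, 0 ≤ a → a < b → b ≤ T → (∀ p ∈ P, p ∉ Ioo a b) →
    ∀ i, ContDiffOn ℝ ∞ (fun p : ℝ × ℝ ↦ Λ p.1 i p.2) (Ioo (-ε) ε ×ˢ Icc a b)

/-- `c` is a normal extremal, with multipliers `lam`, of the functional
`∫₀ᵀ ½ (⟨D²c/dt², D²c/dt²⟩ + σ ‖ċ‖² + V(c)) dt` on `Ω` subject to `⟨μ^a(c), D²c/dt²⟩ = 0`: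
`c ∈ Ω` satisfies the constraints and `(c, lam)` is a critical point of the augmented functional.
Here `c` and `lam` are smooth off the finite set `P`. -/
structure IsNormalExtremal (g : Metric n Q) (μ : Fin m → OneForm n Q) (V : Q → ℝ) (σ T : ℝ)
    (ξ₀ ξT : TangentBundle (𝓡 n) Q) (P : Finset ℝ) (c : ℝ → Q) (lam : Fin m → ℝ → ℝ) : Prop where
  memOmega : MemOmega T ξ₀ ξT P c
  mult_smoothOff : SmoothOffFun T P lam
  constraint : ∀ t ∈ Icc 0 T, t ∉ P → ∀ a, μ a (c t) (accel g T c t) = 0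
  critical : ∀ (ε : ℝ) (P' : Finset ℝ) (α : ℝ → ℝ → Q) (Λ : ℝ → Fin m → ℝ → ℝ),
    IsVariation T ξ₀ ξT c lam ε P' α Λ →
      HasDerivAt (fun s ↦ augmentedFunctional g μ V σ T (α s) (Λ s)) 0 0

end ConstrainedAcceleration

end

/-!
The equation is local, so it is derived at a time `t` off the break points in the chart at `c t`,
where the metric is a smooth field `G` of positive bilinear forms and the curve is `x = x(t)` with
velocity `v`. Write `D` for the covariant derivative, `A = Dv` for the acceleration, `X_a` for the
field dual to `μ a`, and `p = A + ∑ λ_a X_a`.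

Pushing `x` in the direction of a field `ξ` along the curve changes the acceleration covariantly by
`D²ξ + R(ξ, v)v` (`accelVariation_eq`), and hence the integrand of the augmented functional by
`⟨p, D²ξ + R(ξ, v)v⟩ + σ⟨v, Dξ⟩ + ½ dV(ξ) + ∑ λ_a (∇_ξ μ_a)(A)`. Metric compatibility of the
Levi-Civita connection and the symmetry of `u ↦ R(u, v)v` turn this into
`⟨D²p + R(p, v)v - σ A, ξ⟩ + ½ dV(ξ) + ∑ λ_a (∇_ξ μ_a)(A)` plus the derivative of
`⟨p, Dξ⟩ - ⟨Dp, ξ⟩ + σ⟨v, ξ⟩` (`hasDerivAt_boundary`). For `ξ = φ w` with a bump function `φ`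
supported between break points the total derivative integrates to zero, so the fundamental lemma of
the calculus of variations gives the weak equation at interior times (`eulerLagrange_eq_zero`), and
continuity gives it at the end points `0` and `T`. Expanding `D²p` by the Leibniz rule
(`covDeriv_covDeriv_add_sum_smul`) and using `(∇_w μ)(A) = (∇_A μ)(w) - dμ(A, w)
= ⟨∇_A X - S(A), w⟩` yields the equation (`eq_zero_of_eulerLagrange`).

Two points connect this computation to the functional on the manifold. Covariant derivatives are
defined in the chart at the point of evaluation, which moves along the curve; that a single chart
can be used instead is the transformation law of the Christoffel symbols
(`IsMetricOn.fderiv_apply_chrL`, `covD_eq`). And the integral over `[0, T]` may be split into the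
part that varies and a constant part only because the integrand is integrable along every curve of
`Ω` (`integrableOn_integrand`), since the integral of a non-integrable function is `0` by
convention; then the derivative is that of the integral over the chart
(`integral_firstVariation_eq_zero`).
-/

noncomputable section

set_option maxSynthPendingDepth 3
set_option synthInstance.maxHeartbeats 200000

namespace ConstrainedAcceleration

/-! ### Riemannian geometry on an open subset of a vector space -/

section Coordinates

variable {E : Type*} [NormedAddCommGroup E] [NormedSpace ℝ E]

/-- `G` is a smooth Riemannian metric on the open set `U`, given as a field of bilinear forms. -/
structure IsMetricOn (U : Set E) (G : E → E →L[ℝ] E →L[ℝ] ℝ) : Prop where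
  isOpen : IsOpen U
  smooth : ContDiffOn ℝ ∞ G U
  symm : ∀ y ∈ U, ∀ u v, G y u v = G y v u
  pos : ∀ y ∈ U, ∀ v, v ≠ 0 → 0 < G y v v

/-- The Christoffel symbols of `G`, as the map `(u, v) ↦ Γ(u, v)`. -/
def chr (G : E → E →L[ℝ] E →L[ℝ] ℝ) (y u v : E) : E :=
  (G y).inverse
    ((1 / 2 : ℝ) • (fderiv ℝ G y u v + fderiv ℝ G y v u - ((fderiv ℝ G y).flip u).flip v))

/-- The Christoffel symbols of `G` at `y`, as a continuous bilinear map. -/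
def chrL (G : E → E →L[ℝ] E →L[ℝ] ℝ) (y : E) : E →L[ℝ] E →L[ℝ] E :=
  (ContinuousLinearMap.compL ℝ E (E →L[ℝ] ℝ) E (G y).inverse) ∘L
    ((1 / 2 : ℝ) • (fderiv ℝ G y + (fderiv ℝ G y).flip
      - (ContinuousLinearMap.flipₗᵢ ℝ E E ℝ : (E →L[ℝ] E →L[ℝ] ℝ) →L[ℝ] (E →L[ℝ] E →L[ℝ] ℝ)) ∘L
          (fderiv ℝ G y).flip))

theorem chrL_apply (G : E → E →L[ℝ] E →L[ℝ] ℝ) (y u v : E) : chrL G y u v = chr G y u v := rfl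

/-- The curvature tensor `R(u, v)w` of `G` in terms of the Christoffel symbols. -/
def curv (G : E → E →L[ℝ] E →L[ℝ] ℝ) (y u v w : E) : E :=
  fderiv ℝ (chrL G) y u v w - fderiv ℝ (chrL G) y v u w
    + chrL G y u (chrL G y v w) - chrL G y v (chrL G y u w)

theorem two_le_infty : (2 : ℕ∞ω) ≤ ∞ := WithTop.coe_le_coe.2 (le_top : (2 : ℕ∞) ≤ ⊤)

theorem isInvertible_of_pos [FiniteDimensional ℝ E] {B : E →L[ℝ] E →L[ℝ] ℝ}
    (hB : ∀ v, v ≠ 0 → 0 < B v v) :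
    B.IsInvertible := by
  have hinj : Function.Injective B.toLinearMap := by
    rw [← LinearMap.ker_eq_bot, LinearMap.ker_eq_bot']
    intro v hv
    by_contra hne
    have h1 := hB v hne
    have h2 : B v = 0 := hv
    simp [h2] at h1
  have hdim : Module.finrank ℝ E = Module.finrank ℝ (E →L[ℝ] ℝ) := by
    rw [← (LinearMap.toContinuousLinearMap (𝕜 := ℝ) (E := E) (F' := ℝ)).finrank_eq]
    exact (Subspace.dual_finrank_eq (K := ℝ) (V := E)).symm
  exact ⟨(LinearEquiv.ofInjectiveOfFinrankEq B.toLinearMap hinj hdim).toContinuousLinearEquiv,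
    by ext; rfl⟩

theorem eq_of_forall_apply_eq {B : E →L[ℝ] E →L[ℝ] ℝ} (hB : ∀ v, v ≠ 0 → 0 < B v v) {u v : E}
    (h : ∀ w, B u w = B v w) : u = v := by
  by_contra hne
  have := hB (u - v) (sub_ne_zero.2 hne)
  simp [h] at this

theorem fderiv_apply₂ {F₁ F₂ F₃ : Type*} [NormedAddCommGroup F₁] [NormedSpace ℝ F₁]
    [NormedAddCommGroup F₂] [NormedSpace ℝ F₂] [NormedAddCommGroup F₃] [NormedSpace ℝ F₃]
    {G : E → F₁ →L[ℝ] F₂ →L[ℝ] F₃} {y : E} (h : DifferentiableAt ℝ G y) (u : E)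
    (v : F₁) (w : F₂) :
    fderiv ℝ (fun y ↦ G y v w) y u = fderiv ℝ G y u v w := by
  have h1 : HasFDerivAt (fun y ↦ G y v w) _ y :=
    (h.hasFDerivAt.clm_apply (hasFDerivAt_const v y)).clm_apply (hasFDerivAt_const w y)
  rw [h1.fderiv]
  simp

variable {U : Set E} {G : E → E →L[ℝ] E →L[ℝ] ℝ}

theorem curv_swap (y u v w : E) : curv G y u v w = - curv G y v u w := by
  simp only [curv]; abel

namespace IsMetricOn

theorem contDiffAt (hG : IsMetricOn U G) {y : E} (hy : y ∈ U) : ContDiffAt ℝ ∞ G y :=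
  hG.smooth.contDiffAt (hG.isOpen.mem_nhds hy)

theorem differentiableAt (hG : IsMetricOn U G) {y : E} (hy : y ∈ U) : DifferentiableAt ℝ G y :=
  (hG.contDiffAt hy).differentiableAt (by simp)

theorem contDiffAt_fderiv (hG : IsMetricOn U G) {y : E} (hy : y ∈ U) :
    ContDiffAt ℝ ∞ (fderiv ℝ G) y :=
  (hG.contDiffAt hy).fderiv_right (by simp)

theorem eventually_mem (hG : IsMetricOn U G) {y : E} (hy : y ∈ U) : ∀ᶠ z in 𝓝 y, z ∈ U :=
  hG.isOpen.mem_nhds hy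

theorem fderiv_symm (hG : IsMetricOn U G) {y : E} (hy : y ∈ U) (u v w : E) :
    fderiv ℝ G y u v w = fderiv ℝ G y u w v := by
  rw [← fderiv_apply₂ (hG.differentiableAt hy) _ v w,
    ← fderiv_apply₂ (hG.differentiableAt hy) _ w v]
  congr 1
  apply Filter.EventuallyEq.fderiv_eq
  filter_upwards [hG.eventually_mem hy] with z hz using hG.symm z hz v w

variable [FiniteDimensional ℝ E]

theorem isInvertible (hG : IsMetricOn U G) {y : E} (hy : y ∈ U) : (G y).IsInvertible :=
  isInvertible_of_pos (hG.pos y hy)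

theorem contDiffAt_inverse (hG : IsMetricOn U G) {y : E} (hy : y ∈ U) :
    ContDiffAt ℝ ∞ (fun y ↦ (G y).inverse) y :=
  (hG.isInvertible hy).contDiffAt_map_inverse.comp y (hG.contDiffAt hy)

theorem contDiffAt_chrL (hG : IsMetricOn U G) {y : E} (hy : y ∈ U) :
    ContDiffAt ℝ ∞ (chrL G) y := by
  have h1 := hG.contDiffAt_inverse hy
  have h2 := hG.contDiffAt_fderiv hy
  have h3 : ContDiffAt ℝ ∞ (fun y ↦ (fderiv ℝ G y).flip) y :=
    (ContinuousLinearMap.flipₗᵢ ℝ E E (E →L[ℝ] ℝ)).contDiff.contDiffAt.comp y h2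
  unfold chrL
  refine ContDiffAt.clm_comp
    ((ContinuousLinearMap.compL ℝ E (E →L[ℝ] ℝ) E).contDiff.contDiffAt.comp y h1) ?_
  exact ((h2.add h3).sub (contDiffAt_const.clm_comp h3)).const_smul _

theorem differentiableAt_chrL (hG : IsMetricOn U G) {y : E} (hy : y ∈ U) :
    DifferentiableAt ℝ (chrL G) y :=
  (hG.contDiffAt_chrL hy).differentiableAt (by simp)

theorem apply_chrL (hG : IsMetricOn U G) {y : E} (hy : y ∈ U) (u v w : E) :
    G y (chrL G y u v) w =
      1 / 2 * (fderiv ℝ G y u v w + fderiv ℝ G y v u w - fderiv ℝ G y w u v) := by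
  rw [chrL_apply, chr, (hG.isInvertible hy).self_apply_inverse]
  simp

theorem chrL_symm (hG : IsMetricOn U G) {y : E} (hy : y ∈ U) (u v : E) :
    chrL G y u v = chrL G y v u := by
  refine eq_of_forall_apply_eq (hG.pos y hy) fun w ↦ ?_
  rw [hG.apply_chrL hy, hG.apply_chrL hy, hG.fderiv_symm hy w u v]
  ring

/-- Metric compatibility of the Levi-Civita connection. -/
theorem fderiv_eq (hG : IsMetricOn U G) {y : E} (hy : y ∈ U) (u v w : E) :
    fderiv ℝ G y u v w = G y (chrL G y u v) w + G y v (chrL G y u w) := by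
  rw [hG.symm y hy v, hG.apply_chrL hy, hG.apply_chrL hy, hG.fderiv_symm hy w u v,
    hG.fderiv_symm hy v u w, hG.fderiv_symm hy u v w]
  ring

theorem fderiv_chrL_symm (hG : IsMetricOn U G) {y : E} (hy : y ∈ U) (a u v : E) :
    fderiv ℝ (chrL G) y a u v = fderiv ℝ (chrL G) y a v u := by
  rw [← fderiv_apply₂ (hG.differentiableAt_chrL hy) _ u v,
    ← fderiv_apply₂ (hG.differentiableAt_chrL hy) _ v u]
  congr 1
  apply Filter.EventuallyEq.fderiv_eq
  filter_upwards [hG.eventually_mem hy] with z hz using hG.chrL_symm hz u v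

theorem fderiv_fderiv_eq (hG : IsMetricOn U G) {y : E} (hy : y ∈ U) (a b z w : E) :
    fderiv ℝ (fderiv ℝ G) y a b z w =
      fderiv ℝ G y a (chrL G y b z) w + G y (fderiv ℝ (chrL G) y a b z) w
        + (fderiv ℝ G y a z (chrL G y b w) + G y z (fderiv ℝ (chrL G) y a b w)) := by
  have hd := (hG.contDiffAt_fderiv hy).differentiableAt (by simp)
  have hg := (hG.differentiableAt hy).hasFDerivAt
  have hΓ := (hG.differentiableAt_chrL hy).hasFDerivAt
  have hz := (hΓ.clm_apply (hasFDerivAt_const b y)).clm_apply (hasFDerivAt_const z y)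
  have hw := (hΓ.clm_apply (hasFDerivAt_const b y)).clm_apply (hasFDerivAt_const w y)
  have h1 := ((hd.hasFDerivAt.clm_apply (hasFDerivAt_const b y)).clm_apply
    (hasFDerivAt_const z y)).clm_apply (hasFDerivAt_const w y)
  have h2 := ((hg.clm_apply hz).clm_apply (hasFDerivAt_const w y)).add
    ((hg.clm_apply (hasFDerivAt_const z y)).clm_apply hw)
  have h3 := h1.congr_of_eventuallyEq (f₁ := fun y ↦ G y (chrL G y b z) w + G y z (chrL G y b w))
    (by filter_upwards [hG.eventually_mem hy] with x hx using (hG.fderiv_eq hx b z w).symm)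
  have := congrArg (fun L : E →L[ℝ] ℝ ↦ L a) (h3.unique h2)
  simp at this
  linarith

/-- The first Bianchi identity. -/
theorem curv_bianchi (hG : IsMetricOn U G) {y : E} (hy : y ∈ U) (u v w : E) :
    curv G y u v w + curv G y v w u + curv G y w u v = 0 := by
  simp only [curv]
  rw [hG.fderiv_chrL_symm hy u w v, hG.fderiv_chrL_symm hy v u w, hG.fderiv_chrL_symm hy w u v,
    hG.chrL_symm hy w v, hG.chrL_symm hy w u, hG.chrL_symm hy v u]
  abel

/-- `R(u, v)` is skew-adjoint, from the symmetry of the second derivative of the metric. -/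
theorem curv_skew (hG : IsMetricOn U G) {y : E} (hy : y ∈ U) (u v z w : E) :
    G y (curv G y u v z) w = - G y (curv G y u v w) z := by
  have hs : IsSymmSndFDerivAt ℝ G y := (hG.contDiffAt hy).isSymmSndFDerivAt
    (by simp only [minSmoothness_of_isRCLikeNormedField]; exact two_le_infty)
  have h := congrArg (fun L : E →L[ℝ] E →L[ℝ] ℝ ↦ L z w) (hs u v)
  simp only [hG.fderiv_fderiv_eq hy, hG.fderiv_eq hy] at h
  rw [hG.symm y hy _ z]
  simp only [curv, map_add, map_sub, add_apply, sub_apply]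
  have e1 := hG.symm y hy (chrL G y u z) (chrL G y v w)
  have e2 := hG.symm y hy (chrL G y v z) (chrL G y u w)
  linarith

/-- The pair symmetry of the curvature tensor, for the operator `R(·, v)v`. -/
theorem curv_self_adjoint (hG : IsMetricOn U G) {y : E} (hy : y ∈ U) (u v w : E) :
    G y (curv G y u v v) w = G y (curv G y w v v) u := by
  -- the Bianchi identity and antisymmetry for the arguments below give the claim linearly
  have B : ∀ a b c d, G y (curv G y a b c) d + G y (curv G y b c a) d
      + G y (curv G y c a b) d = 0 := fun a b c d ↦ by
    rw [← add_apply, ← add_apply, ← map_add, ← map_add, hG.curv_bianchi hy]; simp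
  have A : ∀ a b c d, G y (curv G y a b c) d = - G y (curv G y b a c) d := fun a b c d ↦ by
    rw [curv_swap]; simp
  have S := hG.curv_skew hy
  have b1 := B u v v w
  have b2 := B w v v u
  have b3 := B u v w v
  have a1 := A v u v w
  have a2 := A v w v u
  have a3 := A w u v v
  have a4 := A u v w v
  have a5 := A v w u v
  have a6 := A v v u w
  have a7 := A v v w u
  have s1 := S u v v w
  have s2 := S v w u v
  have s3 := S w v v u
  have s4 := S w u v v
  linarith

/-- The Christoffel symbols of a metric and of its pullback by `ψ` differ by the second derivative
of `ψ`. -/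
theorem fderiv_apply_chrL {E' : Type*} [NormedAddCommGroup E'] [NormedSpace ℝ E']
    [FiniteDimensional ℝ E'] {U' : Set E'} {G' : E' → E' →L[ℝ] E' →L[ℝ] ℝ}
    (hG : IsMetricOn U G) (hG' : IsMetricOn U' G') {y : E} (hy : y ∈ U) {ψ : E → E'}
    (hψ : ContDiffAt ℝ ∞ ψ y) (hy' : ψ y ∈ U')
    (hsurj : Function.Surjective (fderiv ℝ ψ y))
    (hpull : ∀ᶠ z in 𝓝 y, ∀ a b, G z a b = G' (ψ z) (fderiv ℝ ψ z a) (fderiv ℝ ψ z b))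
    (u v : E) :
    fderiv ℝ ψ y (chrL G y u v) =
      fderiv ℝ (fderiv ℝ ψ) y u v + chrL G' (ψ y) (fderiv ℝ ψ y u) (fderiv ℝ ψ y v) := by
  have hs : IsSymmSndFDerivAt ℝ ψ y := hψ.isSymmSndFDerivAt
    (by simp only [minSmoothness_of_isRCLikeNormedField]; exact two_le_infty)
  have hp := hpull.self_of_nhds
  have hψ1 := (hψ.differentiableAt (by simp)).hasFDerivAt
  have hψ2 : HasFDerivAt (fderiv ℝ ψ) (fderiv ℝ (fderiv ℝ ψ) y) y :=
    ((hψ.fderiv_right (m := ∞) (by simp)).differentiableAt (by simp)).hasFDerivAt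
  have hG'1 := (hG'.differentiableAt hy').hasFDerivAt.comp y hψ1
  -- the derivative of the pullback formula
  have key : ∀ a b c, fderiv ℝ G y c a b =
      fderiv ℝ G' (ψ y) (fderiv ℝ ψ y c) (fderiv ℝ ψ y a) (fderiv ℝ ψ y b)
        + G' (ψ y) (fderiv ℝ (fderiv ℝ ψ) y c a) (fderiv ℝ ψ y b)
        + G' (ψ y) (fderiv ℝ ψ y a) (fderiv ℝ (fderiv ℝ ψ) y c b) := by
    intro a b c
    rw [← fderiv_apply₂ (hG.differentiableAt hy) _ a b]
    have h1 := (hG'1.clm_apply (hψ2.clm_apply (hasFDerivAt_const a y))).clm_apply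
      (hψ2.clm_apply (hasFDerivAt_const b y))
    have h2 := h1.congr_of_eventuallyEq (f₁ := fun z ↦ G z a b)
      (by filter_upwards [hpull] with z hz using hz a b)
    rw [h2.fderiv]
    simp
    ring
  refine eq_of_forall_apply_eq (hG'.pos _ hy') fun w' ↦ ?_
  obtain ⟨w, rfl⟩ := hsurj w'
  rw [← hp, hG.apply_chrL hy, map_add, add_apply, hG'.apply_chrL hy']
  simp only [key]
  rw [hs.eq u w, hs.eq v w, hs.eq v u,
    hG'.symm _ hy' (fderiv ℝ ψ y v) (fderiv ℝ (fderiv ℝ ψ) y w u)]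
  ring

end IsMetricOn

end Coordinates

/-! ### The first variation in coordinates -/

section FirstVariation

variable {E : Type*} [NormedAddCommGroup E] [NormedSpace ℝ E] {m : ℕ}

/-- The integrand of the augmented functional in coordinates, as a function of the position `x`,
velocity `v`, second derivative `z` and multipliers `l`. -/
def lagrangian (G : E → E →L[ℝ] E →L[ℝ] ℝ) (M : Fin m → E → E →L[ℝ] ℝ) (V : E → ℝ) (σ : ℝ)
    (x v z : E) (l : Fin m → ℝ) : ℝ :=
  (1 / 2 : ℝ) * (G x (z + chrL G x v v) (z + chrL G x v v) + σ * G x v v + V x)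
    + ∑ a, l a * M a x (z + chrL G x v v)

/-- The covariant variation of the acceleration when `(x, v, z)` moves in the direction
`(ξ, ξ₁, ξ₂)`. -/
def accelVariation (G : E → E →L[ℝ] E →L[ℝ] ℝ) (x v z ξ ξ₁ ξ₂ : E) : E :=
  ξ₂ + fderiv ℝ (chrL G) x ξ v v + (2 : ℝ) • chrL G x v ξ₁ + chrL G x ξ (z + chrL G x v v)

/-- The derivative of the Lagrangian at `(x, v, z)` in the direction `(ξ, ξ₁, ξ₂)`. -/
def firstVariation (G : E → E →L[ℝ] E →L[ℝ] ℝ) (M : Fin m → E → E →L[ℝ] ℝ) (V : E → ℝ) (σ : ℝ)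
    (x v z : E) (l : Fin m → ℝ) (ξ ξ₁ ξ₂ : E) : ℝ :=
  G x (z + chrL G x v v) (accelVariation G x v z ξ ξ₁ ξ₂) + σ * G x v (ξ₁ + chrL G x v ξ)
    + (1 / 2 : ℝ) * fderiv ℝ V x ξ
    + ∑ a, l a * (M a x (accelVariation G x v z ξ ξ₁ ξ₂) + fderiv ℝ (M a) x ξ (z + chrL G x v v)
        - M a x (chrL G x ξ (z + chrL G x v v)))

/-- The Euler–Lagrange expression paired with `w`, in terms of `p = A + ∑ l_a X_a`, its second
covariant derivative `r`, and the acceleration `A`. -/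
def eulerLagrange (G : E → E →L[ℝ] E →L[ℝ] ℝ) (M : Fin m → E → E →L[ℝ] ℝ) (V : E → ℝ) (σ : ℝ)
    (x v A : E) (l : Fin m → ℝ) (p r w : E) : ℝ :=
  G x (r + curv G x p v v - σ • A) w + (1 / 2 : ℝ) * fderiv ℝ V x w
    + ∑ a, l a * (fderiv ℝ (M a) x w A - M a x (chrL G x w A))

variable [FiniteDimensional ℝ E] {U : Set E} {G : E → E →L[ℝ] E →L[ℝ] ℝ}
  {M : Fin m → E → E →L[ℝ] ℝ} {V : E → ℝ} {σ : ℝ}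

theorem hasDerivAt_lagrangian (hG : IsMetricOn U G) (hM : ∀ a, ContDiffOn ℝ ∞ (M a) U)
    (hV : ContDiffOn ℝ ∞ V U) {x v z : ℝ → E} {l : Fin m → ℝ} {s : ℝ} {ξ ξ₁ ξ₂ : E}
    (hs : x s ∈ U) (hx : HasDerivAt x ξ s) (hv : HasDerivAt v ξ₁ s) (hz : HasDerivAt z ξ₂ s) :
    HasDerivAt (fun s ↦ lagrangian G M V σ (x s) (v s) (z s) l)
      (firstVariation G M V σ (x s) (v s) (z s) l ξ ξ₁ ξ₂) s := by
  have hU := hG.isOpen.mem_nhds hs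
  have hΓ := (hG.differentiableAt_chrL hs).hasFDerivAt.comp_hasDerivAt s hx
  have hA := hz.add ((hΓ.clm_apply hv).clm_apply hv)
  have hg := (hG.differentiableAt hs).hasFDerivAt.comp_hasDerivAt s hx
  have hVd := (((hV.contDiffAt hU).differentiableAt (by simp)).hasFDerivAt).comp_hasDerivAt s hx
  have hMd : ∀ a, HasDerivAt (fun s ↦ M a (x s)) (fderiv ℝ (M a) (x s) ξ) s := fun a ↦
    ((((hM a).contDiffAt hU).differentiableAt (by simp)).hasFDerivAt).comp_hasDerivAt s hx
  have h := ((((hg.clm_apply hA).clm_apply hA).add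
    (((hg.clm_apply hv).clm_apply hv).const_mul σ)).add hVd).const_mul (1 / 2 : ℝ)
  have h2 := HasDerivAt.fun_sum (u := Finset.univ)
    fun a _ ↦ ((hMd a).clm_apply hA).const_mul (l a)
  refine (h.add h2).congr_deriv ?_
  simp only [firstVariation, accelVariation, Function.comp_apply, Pi.add_apply, add_apply]
  congr 1
  · simp only [hG.fderiv_eq hs, map_add, map_smul, smul_eq_mul, add_apply]
    simp only [hG.chrL_symm hs ξ₁ (v s), hG.chrL_symm hs ξ (v s),
      hG.symm _ hs _ (z s), hG.symm _ hs _ (v s)]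
    simp only [hG.symm _ hs _ (chrL G (x s) (v s) (v s))]
    ring
  · refine Finset.sum_congr rfl fun a _ ↦ ?_
    simp only [map_add, map_smul, smul_eq_mul, hG.chrL_symm hs ξ₁ (v s)]
    ring

/-- The product rule for the metric along a curve. -/
theorem hasDerivAt_metric (hG : IsMetricOn U G) {x u w : ℝ → E} {x' u' w' : E} {t : ℝ}
    (ht : x t ∈ U) (hx : HasDerivAt x x' t) (hu : HasDerivAt u u' t) (hw : HasDerivAt w w' t) :
    HasDerivAt (fun t ↦ G (x t) (u t) (w t))
      (G (x t) (u' + chrL G (x t) x' (u t)) (w t)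
        + G (x t) (u t) (w' + chrL G (x t) x' (w t))) t := by
  have hg := (hG.differentiableAt ht).hasFDerivAt.comp_hasDerivAt t hx
  refine ((hg.clm_apply hu).clm_apply hw).congr_deriv ?_
  simp only [hG.fderiv_eq ht, map_add, add_apply, Function.comp_apply]
  ring

/-- Commuting the variation with the time derivative produces a curvature term. -/
theorem accelVariation_eq (hG : IsMetricOn U G) {x v z ξ ξ₁ ξ₂ : E} (hx : x ∈ U) :
    accelVariation G x v z ξ ξ₁ ξ₂ =
      (ξ₂ + (fderiv ℝ (chrL G) x v v ξ + chrL G x z ξ + chrL G x v ξ₁)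
        + chrL G x v (ξ₁ + chrL G x v ξ)) + curv G x ξ v v := by
  simp only [accelVariation, curv, map_add, two_smul, hG.fderiv_chrL_symm hx v ξ v,
    hG.chrL_symm hx z ξ, hG.chrL_symm hx v ξ]
  abel

/-- Up to a total derivative, the first variation is the Euler–Lagrange expression. -/
theorem hasDerivAt_boundary (hG : IsMetricOn U G) {X : Fin m → E}
    {x v p q ξ ξ₁ : ℝ → E} {z p' q' ξ₂ : E} {l : Fin m → ℝ} {t : ℝ} (ht : x t ∈ U)
    (hX : ∀ a w, G (x t) (X a) w = M a (x t) w)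
    (hx : HasDerivAt x (v t) t) (hv : HasDerivAt v z t)
    (hp : HasDerivAt p p' t) (hq : HasDerivAt q q' t)
    (hpt : p t = z + chrL G (x t) (v t) (v t) + ∑ a, l a • X a)
    (hqt : q t = p' + chrL G (x t) (v t) (p t))
    (hξ : HasDerivAt ξ (ξ₁ t) t) (hξ₁ : HasDerivAt ξ₁ ξ₂ t) :
    HasDerivAt (fun t ↦ G (x t) (p t) (ξ₁ t + chrL G (x t) (v t) (ξ t)) - G (x t) (q t) (ξ t)
        + σ * G (x t) (v t) (ξ t))
      (firstVariation G M V σ (x t) (v t) z l (ξ t) (ξ₁ t) ξ₂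
        - eulerLagrange G M V σ (x t) (v t) (z + chrL G (x t) (v t) (v t)) l (p t)
            (q' + chrL G (x t) (v t) (q t)) (ξ t)) t := by
  have hΓ := (hG.differentiableAt_chrL ht).hasFDerivAt.comp_hasDerivAt t hx
  have hD := hξ₁.add ((hΓ.clm_apply hv).clm_apply hξ)
  refine (((hasDerivAt_metric hG ht hx hp hD).sub (hasDerivAt_metric hG ht hx hq hξ)).add
    ((hasDerivAt_metric hG ht hx hv hξ).const_mul σ)).congr_deriv ?_
  simp only [Function.comp_apply, Pi.add_apply]
  rw [← hqt]
  have hM : ∀ a w, M a (x t) w = G (x t) (X a) w := fun a w ↦ (hX a w).symm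
  have hsum : ∀ w, G (x t) (p t) w = G (x t) (z + chrL G (x t) (v t) (v t)) w
      + ∑ a, l a * G (x t) (X a) w := fun w ↦ by
    rw [hpt, map_add, map_sum]
    simp
  have hR : G (x t) (curv G (x t) (p t) (v t) (v t)) (ξ t)
      = G (x t) (p t) (curv G (x t) (ξ t) (v t) (v t)) := by
    rw [hG.curv_self_adjoint ht, hG.symm _ ht]
  simp only [firstVariation, eulerLagrange, map_add, map_sub, map_smul, add_apply, sub_apply,
    smul_apply, smul_eq_mul, hR, accelVariation_eq hG ht, hM, hsum, mul_add, mul_sub,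
    Finset.sum_add_distrib, Finset.sum_sub_distrib]
  ring

end FirstVariation

/-! ### The Euler–Lagrange equation in coordinates -/

section EulerLagrange

variable {E : Type*} [NormedAddCommGroup E] [NormedSpace ℝ E] {m : ℕ}

theorem exists_pos_forall_add_smul_mem {K : Set ℝ} (hK : IsCompact K) {U : Set E} (hU : IsOpen U)
    {x ξ : ℝ → E} (hx : ContinuousOn x K) (hξ : ContinuousOn ξ K) (hxU : ∀ t ∈ K, x t ∈ U) :
    ∃ ε > 0, ∀ s : ℝ, |s| ≤ ε → ∀ t ∈ K, x t + s • ξ t ∈ U := by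
  obtain ⟨δ, hδ, hsub⟩ := (hK.image_of_continuousOn hx).exists_thickening_subset_open hU
    (image_subset_iff.2 hxU)
  obtain ⟨C, hC⟩ := hK.exists_bound_of_continuousOn hξ
  refine ⟨δ / (2 * (|C| + 1)), by positivity, fun s hs t ht ↦ hsub ?_⟩
  rw [Metric.mem_thickening_iff]
  refine ⟨x t, mem_image_of_mem x ht, ?_⟩
  rw [dist_eq_norm, add_sub_cancel_left, norm_smul, Real.norm_eq_abs]
  have h1 : ‖ξ t‖ ≤ |C| + 1 := ((hC t ht).trans (le_abs_self C)).trans (by linarith)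
  calc |s| * ‖ξ t‖ ≤ δ / (2 * (|C| + 1)) * (|C| + 1) := by gcongr
    _ = δ / 2 := by field_simp
    _ < δ := by linarith

variable [FiniteDimensional ℝ E] {U : Set E} {G : E → E →L[ℝ] E →L[ℝ] ℝ}
  {M : Fin m → E → E →L[ℝ] ℝ} {V : E → ℝ} {σ : ℝ}

section Continuity

variable {Y : Type*} [TopologicalSpace Y] {S : Set Y}

theorem IsMetricOn.continuousOn_chrL (hG : IsMetricOn U G) : ContinuousOn (chrL G) U :=
  fun _ hy ↦ (hG.contDiffAt_chrL hy).continuousAt.continuousWithinAt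

theorem IsMetricOn.continuousOn_fderiv_chrL (hG : IsMetricOn U G) :
    ContinuousOn (fderiv ℝ (chrL G)) U :=
  fun _ hy ↦
    ((hG.contDiffAt_chrL hy).fderiv_right (m := 0) (by simp)).continuousAt.continuousWithinAt

theorem continuousOn_lagrangian (hG : IsMetricOn U G) (hM : ∀ a, ContDiffOn ℝ ∞ (M a) U)
    (hV : ContDiffOn ℝ ∞ V U) {x v z : Y → E} {l : Y → Fin m → ℝ}
    (hxU : MapsTo x S U) (hx : ContinuousOn x S) (hv : ContinuousOn v S) (hz : ContinuousOn z S)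
    (hl : ∀ a, ContinuousOn (fun t ↦ l t a) S) :
    ContinuousOn (fun t ↦ lagrangian G M V σ (x t) (v t) (z t) (l t)) S := by
  have h1 := hG.smooth.continuousOn.comp hx hxU
  have h2 := hG.continuousOn_chrL.comp hx hxU
  have h3 := hV.continuousOn.comp hx hxU
  have h4 := fun a ↦ (hM a).continuousOn.comp hx hxU
  have hA := hz.add ((h2.clm_apply hv).clm_apply hv)
  exact (continuousOn_const.mul ((((h1.clm_apply hA).clm_apply hA).add
    (continuousOn_const.mul ((h1.clm_apply hv).clm_apply hv))).add h3)).add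
    (continuousOn_finsetSum _ fun a _ ↦ (hl a).mul ((h4 a).clm_apply hA))

theorem continuousOn_firstVariation (hG : IsMetricOn U G) (hM : ∀ a, ContDiffOn ℝ ∞ (M a) U)
    (hV : ContDiffOn ℝ ∞ V U) {x v z ξ ξ₁ ξ₂ : Y → E} {l : Y → Fin m → ℝ}
    (hxU : MapsTo x S U) (hx : ContinuousOn x S) (hv : ContinuousOn v S) (hz : ContinuousOn z S)
    (hl : ∀ a, ContinuousOn (fun t ↦ l t a) S)
    (hξ : ContinuousOn ξ S) (hξ₁ : ContinuousOn ξ₁ S) (hξ₂ : ContinuousOn ξ₂ S) :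
    ContinuousOn
      (fun t ↦ firstVariation G M V σ (x t) (v t) (z t) (l t) (ξ t) (ξ₁ t) (ξ₂ t)) S := by
  have h1 := hG.smooth.continuousOn.comp hx hxU
  have h2 := hG.continuousOn_chrL.comp hx hxU
  have h3 := (hV.continuousOn_fderiv_of_isOpen hG.isOpen (by simp)).comp hx hxU
  have h4 := fun a ↦ (hM a).continuousOn.comp hx hxU
  have h5 := fun a ↦ ((hM a).continuousOn_fderiv_of_isOpen hG.isOpen (by simp)).comp hx hxU
  have h6 := hG.continuousOn_fderiv_chrL.comp hx hxU
  have hA := hz.add ((h2.clm_apply hv).clm_apply hv)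
  have hδ := ((hξ₂.add (((h6.clm_apply hξ).clm_apply hv).clm_apply hv)).add
    (((h2.clm_apply hv).clm_apply hξ₁).const_smul (2 : ℝ))).add ((h2.clm_apply hξ).clm_apply hA)
  exact ((((h1.clm_apply hA).clm_apply hδ).add (continuousOn_const.mul
    ((h1.clm_apply hv).clm_apply (hξ₁.add ((h2.clm_apply hv).clm_apply hξ))))).add
    (continuousOn_const.mul (h3.clm_apply hξ))).add
    (continuousOn_finsetSum _ fun a _ ↦ (hl a).mul ((((h4 a).clm_apply hδ).add
      (((h5 a).clm_apply hξ).clm_apply hA)).sub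
      ((h4 a).clm_apply ((h2.clm_apply hξ).clm_apply hA))))

theorem continuousOn_eulerLagrange (hG : IsMetricOn U G) (hM : ∀ a, ContDiffOn ℝ ∞ (M a) U)
    (hV : ContDiffOn ℝ ∞ V U) {x v A p r w : Y → E} {l : Y → Fin m → ℝ}
    (hxU : MapsTo x S U) (hx : ContinuousOn x S) (hv : ContinuousOn v S) (hA : ContinuousOn A S)
    (hl : ∀ a, ContinuousOn (fun t ↦ l t a) S)
    (hp : ContinuousOn p S) (hr : ContinuousOn r S) (hw : ContinuousOn w S) :
    ContinuousOn (fun t ↦ eulerLagrange G M V σ (x t) (v t) (A t) (l t) (p t) (r t) (w t)) S := by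
  have h1 := hG.smooth.continuousOn.comp hx hxU
  have h2 := hG.continuousOn_chrL.comp hx hxU
  have h3 := (hV.continuousOn_fderiv_of_isOpen hG.isOpen (by simp)).comp hx hxU
  have h4 := fun a ↦ (hM a).continuousOn.comp hx hxU
  have h5 := fun a ↦ ((hM a).continuousOn_fderiv_of_isOpen hG.isOpen (by simp)).comp hx hxU
  have h6 := hG.continuousOn_fderiv_chrL.comp hx hxU
  have hR := (((((h6.clm_apply hp).clm_apply hv).clm_apply hv).sub
    (((h6.clm_apply hv).clm_apply hp).clm_apply hv)).add
    ((h2.clm_apply hp).clm_apply ((h2.clm_apply hv).clm_apply hv))).sub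
    ((h2.clm_apply hv).clm_apply ((h2.clm_apply hp).clm_apply hv))
  exact (((h1.clm_apply ((hr.add hR).sub (hA.const_smul σ))).clm_apply hw).add
    (continuousOn_const.mul (h3.clm_apply hw))).add
    (continuousOn_finsetSum _ fun a _ ↦ (hl a).mul ((((h5 a).clm_apply hw).clm_apply hA).sub
      ((h4 a).clm_apply ((h2.clm_apply hw).clm_apply hA))))

end Continuity

theorem hasDerivAt_integral_lagrangian (hG : IsMetricOn U G) (hM : ∀ a, ContDiffOn ℝ ∞ (M a) U)
    (hV : ContDiffOn ℝ ∞ V U) {a b : ℝ} (hab : a ≤ b) {x v z ξ ξ₁ ξ₂ : ℝ → E} {l : ℝ → Fin m → ℝ}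
    (hxU : ∀ t ∈ Icc a b, x t ∈ U) (hx : ContinuousOn x (Icc a b)) (hv : ContinuousOn v (Icc a b))
    (hz : ContinuousOn z (Icc a b)) (hl : ∀ i, ContinuousOn (fun t ↦ l t i) (Icc a b))
    (hξ : ContinuousOn ξ (Icc a b)) (hξ₁ : ContinuousOn ξ₁ (Icc a b))
    (hξ₂ : ContinuousOn ξ₂ (Icc a b)) :
    HasDerivAt (fun s : ℝ ↦ ∫ t in a..b, lagrangian G M V σ (x t + s • ξ t) (v t + s • ξ₁ t)
        (z t + s • ξ₂ t) (l t))
      (∫ t in a..b, firstVariation G M V σ (x t) (v t) (z t) (l t) (ξ t) (ξ₁ t) (ξ₂ t)) 0 := by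
  obtain ⟨ε, hε, hmem⟩ := exists_pos_forall_add_smul_mem isCompact_Icc hG.isOpen hx hξ hxU
  have hsub : uIoc a b ⊆ Icc a b := by rw [uIoc_of_le hab]; exact Ioc_subset_Icc_self
  have hball : ∀ s ∈ Metric.ball (0 : ℝ) ε, |s| ≤ ε := fun s hs ↦ by
    simpa using (mem_ball_zero_iff.1 hs).le
  have hlag : ∀ s : ℝ, |s| ≤ ε → ContinuousOn (fun t ↦ lagrangian G M V σ (x t + s • ξ t)
      (v t + s • ξ₁ t) (z t + s • ξ₂ t) (l t)) (Icc a b) := fun s hs ↦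
    continuousOn_lagrangian hG hM hV (fun t ht ↦ hmem s hs t ht) (by fun_prop) (by fun_prop)
      (by fun_prop) hl
  let D : ℝ × ℝ → ℝ := fun y ↦ firstVariation G M V σ (x y.2 + y.1 • ξ y.2) (v y.2 + y.1 • ξ₁ y.2)
    (z y.2 + y.1 • ξ₂ y.2) (l y.2) (ξ y.2) (ξ₁ y.2) (ξ₂ y.2)
  have hD : ContinuousOn D (Icc (-ε) ε ×ˢ Icc a b) := by
    have hm : MapsTo Prod.snd (Icc (-ε) ε ×ˢ Icc a b) (Icc a b) := fun y hy ↦ hy.2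
    have c : ∀ {F : Type _} [TopologicalSpace F] {f : ℝ → F}, ContinuousOn f (Icc a b) →
        ContinuousOn (fun y : ℝ × ℝ ↦ f y.2) (Icc (-ε) ε ×ˢ Icc a b) :=
      fun hf ↦ hf.comp continuousOn_snd hm
    have cs : ContinuousOn (fun y : ℝ × ℝ ↦ y.1) (Icc (-ε) ε ×ˢ Icc a b) := continuousOn_fst
    exact continuousOn_firstVariation hG hM hV (fun y hy ↦ hmem _ (abs_le.2 hy.1) _ hy.2)
      ((c hx).add (cs.smul (c hξ))) ((c hv).add (cs.smul (c hξ₁))) ((c hz).add (cs.smul (c hξ₂)))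
      (fun i ↦ (hl i).comp continuousOn_snd hm) (c hξ) (c hξ₁) (c hξ₂)
  obtain ⟨C, hC⟩ := (isCompact_Icc.prod isCompact_Icc).exists_bound_of_continuousOn hD
  have h0 : ContinuousOn (fun t : ℝ ↦ D (0, t)) (Icc a b) :=
    hD.comp (by fun_prop) fun t ht ↦ ⟨⟨by linarith, hε.le⟩, ht⟩
  have key := (intervalIntegral.hasDerivAt_integral_of_dominated_loc_of_deriv_le (μ := volume)
    (F := fun s t ↦ lagrangian G M V σ (x t + s • ξ t) (v t + s • ξ₁ t) (z t + s • ξ₂ t) (l t))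
    (F' := fun s t ↦ D (s, t)) (x₀ := (0 : ℝ)) (a := a) (b := b) (bound := fun _ ↦ C)
    (Metric.ball_mem_nhds 0 hε)
    (by
      filter_upwards [Metric.ball_mem_nhds 0 hε] with s hs
      exact ((hlag s (hball s hs)).mono hsub).aestronglyMeasurable measurableSet_uIoc)
    ((hlag 0 (by simpa using hε.le)).intervalIntegrable_of_Icc hab)
    ((h0.mono hsub).aestronglyMeasurable measurableSet_uIoc)
    (.of_forall fun t ht s hs ↦ hC (s, t) ⟨abs_le.1 (hball s hs), hsub ht⟩)
    intervalIntegrable_const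
    (.of_forall fun t ht s hs ↦ by
      have hd : ∀ f g : ℝ → E, HasDerivAt (fun s : ℝ ↦ f t + s • g t) (g t) s := fun f g ↦ by
        simpa using ((hasDerivAt_id s).smul_const (g t)).const_add (f t)
      exact hasDerivAt_lagrangian hG hM hV (hmem s (hball s hs) t (hsub ht)) (hd x ξ) (hd v ξ₁)
        (hd z ξ₂))).2
  simpa [D] using key

/-- The Euler–Lagrange equation at interior points, by the fundamental lemma of the calculus of
variations. -/
theorem eulerLagrange_eq_zero (hG : IsMetricOn U G) (hM : ∀ a, ContDiffOn ℝ ∞ (M a) U)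
    (hV : ContDiffOn ℝ ∞ V U) {a b : ℝ} (hab : a < b) {X : Fin m → ℝ → E}
    {x v z p q p' q' : ℝ → E} {l : ℝ → Fin m → ℝ}
    (hxU : ∀ t ∈ Icc a b, x t ∈ U)
    (hX : ∀ t ∈ Ioo a b, ∀ i w, G (x t) (X i t) w = M i (x t) w)
    (cx : ContinuousOn x (Icc a b)) (cv : ContinuousOn v (Icc a b))
    (cz : ContinuousOn z (Icc a b)) (cp : ContinuousOn p (Icc a b)) (cq : ContinuousOn q (Icc a b))
    (cq' : ContinuousOn q' (Icc a b)) (cl : ∀ i, ContinuousOn (fun t ↦ l t i) (Icc a b))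
    (hx : ∀ t ∈ Ioo a b, HasDerivAt x (v t) t) (hv : ∀ t ∈ Ioo a b, HasDerivAt v (z t) t)
    (hp : ∀ t ∈ Ioo a b, HasDerivAt p (p' t) t) (hq : ∀ t ∈ Ioo a b, HasDerivAt q (q' t) t)
    (hpt : ∀ t ∈ Ioo a b, p t = z t + chrL G (x t) (v t) (v t) + ∑ i, l t i • X i t)
    (hqt : ∀ t ∈ Ioo a b, q t = p' t + chrL G (x t) (v t) (p t))
    (hcrit : ∀ φ : ℝ → ℝ, ContDiff ℝ ∞ φ → HasCompactSupport φ → tsupport φ ⊆ Ioo a b →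
      ∀ w, ∫ t in a..b, firstVariation G M V σ (x t) (v t) (z t) (l t) (φ t • w) (deriv φ t • w)
        (deriv (deriv φ) t • w) = 0) (w : E) :
    ∀ t ∈ Ioo a b, eulerLagrange G M V σ (x t) (v t) (z t + chrL G (x t) (v t) (v t)) (l t) (p t)
      (q' t + chrL G (x t) (v t) (q t)) w = 0 := by
  have cG := hG.smooth.continuousOn.comp cx hxU
  have cΓ := hG.continuousOn_chrL.comp cx hxU
  have cA := cz.add ((cΓ.clm_apply cv).clm_apply cv)
  have cr := cq'.add ((cΓ.clm_apply cv).clm_apply cq)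
  have cEL : ∀ u : ℝ → E, ContinuousOn u (Icc a b) →
      ContinuousOn (fun t ↦ eulerLagrange G M V σ (x t) (v t)
        (z t + chrL G (x t) (v t) (v t)) (l t) (p t)
        (q' t + chrL G (x t) (v t) (q t)) (u t)) (Icc a b) := fun u hu ↦
    continuousOn_eulerLagrange hG hM hV hxU cx cv cA cl cp cr hu
  have ce := (cEL (fun _ ↦ w) continuousOn_const).mono (Ioo_subset_Icc_self (a := a) (b := b))
  have hae := isOpen_Ioo.ae_eq_zero_of_integral_contDiff_smul_eq_zero (μ := volume)
    (ce.locallyIntegrableOn measurableSet_Ioo) (fun φ hφ hc hs ↦ ?_)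
  · exact Measure.eqOn_open_of_ae_eq (μ := volume) (g := fun _ ↦ (0 : ℝ))
      ((ae_restrict_iff' measurableSet_Ioo).2 hae) isOpen_Ioo ce continuousOn_const
  have hφ1 : ContDiff ℝ ∞ (deriv φ) := (contDiff_infty_iff_deriv.1 hφ).2
  have hφ2 : ContDiff ℝ ∞ (deriv (deriv φ)) := (contDiff_infty_iff_deriv.1 hφ1).2
  have c0 := hφ.continuous
  have c1 := hφ1.continuous
  have c2 := hφ2.continuous
  have cf0 : ContinuousOn (fun t ↦ φ t • w) (Icc a b) := by fun_prop
  have cf1 : ContinuousOn (fun t ↦ deriv φ t • w) (Icc a b) := by fun_prop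
  have d0 : ∀ t, HasDerivAt (fun t ↦ φ t • w) (deriv φ t • w) t := fun t ↦
    ((hφ.differentiable (by simp) t).hasDerivAt).smul_const w
  have d1 : ∀ t, HasDerivAt (fun t ↦ deriv φ t • w) (deriv (deriv φ) t • w) t := fun t ↦
    ((hφ1.differentiable (by simp) t).hasDerivAt).smul_const w
  have ibp := intervalIntegral.integral_eq_sub_of_hasDerivAt_of_le hab.le
    (f := fun t ↦ G (x t) (p t) (deriv φ t • w + chrL G (x t) (v t) (φ t • w))
        - G (x t) (q t) (φ t • w) + σ * G (x t) (v t) (φ t • w))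
    ((((cG.clm_apply cp).clm_apply (cf1.add ((cΓ.clm_apply cv).clm_apply cf0))).sub
      ((cG.clm_apply cq).clm_apply cf0)).add
      (continuousOn_const.mul ((cG.clm_apply cv).clm_apply cf0)))
    (fun t ht ↦ hasDerivAt_boundary (M := M) (V := V) (l := l t) (X := fun i ↦ X i t) hG
      (hxU t (Ioo_subset_Icc_self ht)) (hX t ht)
      (hx t ht) (hv t ht) (hp t ht) (hq t ht) (hpt t ht) (hqt t ht) (d0 t) (d1 t))
    (ContinuousOn.intervalIntegrable_of_Icc hab.le
      ((continuousOn_firstVariation hG hM hV hxU cx cv cz cl (by fun_prop) (by fun_prop)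
        (by fun_prop)).sub (cEL (fun t ↦ φ t • w) (by fun_prop))))
  have hz0 : ∀ t, t ∉ Ioo a b → φ t = 0 ∧ deriv φ t = 0 := fun t ht ↦ by
    have h1 : φ t = 0 := image_eq_zero_of_notMem_tsupport fun h ↦ ht (hs h)
    have h2 : deriv φ t = 0 := image_eq_zero_of_notMem_tsupport fun h ↦
      ht (hs (tsupport_deriv_subset (𝕜 := ℝ) h))
    exact ⟨h1, h2⟩
  rw [intervalIntegral.integral_sub, hcrit φ hφ hc hs w] at ibp
  · simp only [(hz0 a (by simp)).1, (hz0 a (by simp)).2, (hz0 b (by simp)).1,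
      (hz0 b (by simp)).2, zero_smul, map_zero, add_zero, mul_zero, sub_zero, zero_sub,
      neg_eq_zero] at ibp
    rw [← intervalIntegral.integral_eq_integral_of_support_subset (a := a) (b := b)]
    · rw [← ibp]
      refine intervalIntegral.integral_congr fun t _ ↦ ?_
      simp only [eulerLagrange, map_smul, smul_apply, smul_eq_mul, mul_add, Finset.mul_sum]
      congr 1
      · ring
      · exact Finset.sum_congr rfl fun i _ ↦ by ring
    · intro t ht
      by_contra h
      exact ht (by simp [(hz0 t fun h' ↦ h (Ioo_subset_Ioc_self h')).1])
  · exact ContinuousOn.intervalIntegrable_of_Icc hab.le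
      (continuousOn_firstVariation hG hM hV hxU cx cv cz cl (by fun_prop) (by fun_prop)
        (by fun_prop))
  · exact ContinuousOn.intervalIntegrable_of_Icc hab.le (cEL (fun t ↦ φ t • w) (by fun_prop))

end EulerLagrange

/-! ### Tangent vectors in a chart -/

section Chart

variable {n m : ℕ} {Q : Type*} [TopologicalSpace Q] [ChartedSpace (EuclideanSpace ℝ (Fin n)) Q]

/-- The components in the chart at `x₀` of tangent vectors at `q`. The tangent space at `q` is
replaced by the model space, to which it is definitionally equal, so that maps and equations no
longer depend on `q` in their type. -/
def coframe (x₀ q : Q) : EuclideanSpace ℝ (Fin n) →L[ℝ] EuclideanSpace ℝ (Fin n) := toCoord x₀ q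

/-- The coordinate frame at `q` of the chart at `x₀`: the tangent vector at `q` with given
components, as a map between model spaces. -/
def frame (x₀ q : Q) : EuclideanSpace ℝ (Fin n) →L[ℝ] EuclideanSpace ℝ (Fin n) :=
  ofCoord x₀ (extChartAt (𝓡 n) x₀ q)

/-- The metric at `q` as a bilinear form on the model space. -/
def innerModel [IsManifold (𝓡 n) ∞ Q] (g : Metric n Q) (q : Q) :
    EuclideanSpace ℝ (Fin n) →L[ℝ] EuclideanSpace ℝ (Fin n) →L[ℝ] ℝ := g.inner q

/-- The value of a 1-form at `q` as a functional on the model space. -/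
def formModel (μ : OneForm n Q) (q : Q) : EuclideanSpace ℝ (Fin n) →L[ℝ] ℝ := μ q

variable [IsManifold (𝓡 n) ∞ Q]

theorem frame_coframe {x₀ q : Q} (hq : q ∈ (extChartAt (𝓡 n) x₀).source)
    (v : EuclideanSpace ℝ (Fin n)) : frame x₀ q (coframe x₀ q v) = v := by
  have h := mfderivWithin_extChartAt_symm_comp_mfderiv_extChartAt' (I := 𝓡 n) hq
  rw [ModelWithCorners.range_eq_univ, mfderivWithin_univ] at h
  exact congrArg (fun L : EuclideanSpace ℝ (Fin n) →L[ℝ] EuclideanSpace ℝ (Fin n) ↦ L v) h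

theorem coframe_frame {x₀ q : Q} (hq : q ∈ (extChartAt (𝓡 n) x₀).source)
    (v : EuclideanSpace ℝ (Fin n)) : coframe x₀ q (frame x₀ q v) = v := by
  have h := mfderiv_extChartAt_comp_mfderivWithin_extChartAt_symm' (I := 𝓡 n) hq
  rw [ModelWithCorners.range_eq_univ, mfderivWithin_univ] at h
  exact congrArg (fun L : EuclideanSpace ℝ (Fin n) →L[ℝ] EuclideanSpace ℝ (Fin n) ↦ L v) h

theorem coframe_self (q : Q) : coframe q q = ContinuousLinearMap.id ℝ (EuclideanSpace ℝ (Fin n)) :=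
  mfderiv_extChartAt_self (I := 𝓡 n) (x := q)

theorem frame_self (q : Q) : frame q q = ContinuousLinearMap.id ℝ (EuclideanSpace ℝ (Fin n)) := by
  ext1 v
  have := frame_coframe (mem_extChartAt_source (I := 𝓡 n) q) v
  rwa [coframe_self] at this

theorem fromCoordAt_eq (q : Q) (v : EuclideanSpace ℝ (Fin n)) : fromCoordAt q v = v := by
  have h : fromCoordAt q = ContinuousLinearMap.inverse (coframe (n := n) q q) := rfl
  rw [h, coframe_self, ContinuousLinearMap.inverse_id]
  rfl

omit [IsManifold (𝓡 n) ∞ Q] in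
theorem ofCoord_eq {x₀ : Q} {y : EuclideanSpace ℝ (Fin n)} (hy : y ∈ (extChartAt (𝓡 n) x₀).target) :
    (ofCoord x₀ y : EuclideanSpace ℝ (Fin n) →L[ℝ] EuclideanSpace ℝ (Fin n)) =
      frame x₀ ((extChartAt (𝓡 n) x₀).symm y) := by
  rw [frame, (extChartAt (𝓡 n) x₀).right_inv hy]

theorem metricCoord_eq (g : Metric n Q) {x₀ : Q} {y : EuclideanSpace ℝ (Fin n)}
    (hy : y ∈ (extChartAt (𝓡 n) x₀).target) (u v : EuclideanSpace ℝ (Fin n)) :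
    metricCoord g x₀ y u v = innerModel g ((extChartAt (𝓡 n) x₀).symm y)
      (frame x₀ ((extChartAt (𝓡 n) x₀).symm y) u) (frame x₀ ((extChartAt (𝓡 n) x₀).symm y) v) := by
  rw [← ofCoord_eq hy]
  rfl

theorem metricCoord_extChartAt (g : Metric n Q) {x₀ q : Q}
    (hq : q ∈ (extChartAt (𝓡 n) x₀).source) (u v : EuclideanSpace ℝ (Fin n)) :
    metricCoord g x₀ (extChartAt (𝓡 n) x₀ q) u v =
      innerModel g q (frame x₀ q u) (frame x₀ q v) := by
  rw [metricCoord_eq g ((extChartAt (𝓡 n) x₀).map_source hq), (extChartAt (𝓡 n) x₀).left_inv hq]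

omit [IsManifold (𝓡 n) ∞ Q] in
theorem formCoord_eq (μ : OneForm n Q) {x₀ : Q} {y : EuclideanSpace ℝ (Fin n)}
    (hy : y ∈ (extChartAt (𝓡 n) x₀).target) (u : EuclideanSpace ℝ (Fin n)) :
    formCoord μ x₀ y u = formModel μ ((extChartAt (𝓡 n) x₀).symm y)
      (frame x₀ ((extChartAt (𝓡 n) x₀).symm y) u) := by
  rw [← ofCoord_eq hy]
  rfl

omit [IsManifold (𝓡 n) ∞ Q] in
theorem formCoord_extChartAt (μ : OneForm n Q) {x₀ q : Q}
    (hq : q ∈ (extChartAt (𝓡 n) x₀).source) (u : EuclideanSpace ℝ (Fin n)) :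
    formCoord μ x₀ (extChartAt (𝓡 n) x₀ q) u = formModel μ q (frame x₀ q u) := by
  rw [formCoord_eq μ ((extChartAt (𝓡 n) x₀).map_source hq), (extChartAt (𝓡 n) x₀).left_inv hq]

/-- Coordinate vector fields are smooth. -/
theorem contMDiffOn_ofCoord (x₀ : Q) (u : EuclideanSpace ℝ (Fin n)) :
    ContMDiffOn 𝓘(ℝ, EuclideanSpace ℝ (Fin n)) ((𝓡 n).prod 𝓘(ℝ, EuclideanSpace ℝ (Fin n))) ∞
      (fun y ↦ TotalSpace.mk' (EuclideanSpace ℝ (Fin n)) (E := fun q : Q ↦ TangentSpace (𝓡 n) q)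
        ((extChartAt (𝓡 n) x₀).symm y) (ofCoord x₀ y u)) (extChartAt (𝓡 n) x₀).target := by
  have hs : ∀ y ∈ (extChartAt (𝓡 n) x₀).target, (extChartAt (𝓡 n) x₀).symm y ∈
      (extChartAt (𝓡 n) x₀).source := fun y hy ↦ (extChartAt (𝓡 n) x₀).map_target hy
  rw [Trivialization.contMDiffOn_iff (e := trivializationAt (EuclideanSpace ℝ (Fin n))
    (fun q : Q ↦ TangentSpace (𝓡 n) q) x₀)]
  · refine ⟨contMDiffOn_extChartAt_symm x₀, (contMDiffOn_const (c := u)).congr fun y hy ↦ ?_⟩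
    have h1 := hs y hy
    rw [extChartAt_source] at h1
    have h2 := TangentBundle.continuousLinearMapAt_trivializationAt (I := 𝓡 n) h1
    have h3 := coframe_frame (hs y hy) u
    rw [← ofCoord_eq hy] at h3
    refine Eq.trans ?_ h3
    refine Eq.trans ?_ (congrArg (fun L : EuclideanSpace ℝ (Fin n) →L[ℝ] EuclideanSpace ℝ (Fin n) ↦
      L (ofCoord x₀ y u)) h2)
    exact (Trivialization.continuousLinearMapAt_apply_of_mem ℝ _ (by simpa using h1) _).symm
  · intro y hy
    have h1 := hs y hy
    rw [extChartAt_source] at h1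
    rw [Trivialization.mem_source]
    simpa using h1

omit [IsManifold (𝓡 n) ∞ Q] in
theorem contDiffOn_of_totalSpace {x₀ : Q} {f : EuclideanSpace ℝ (Fin n) → ℝ}
    (h : ContMDiffOn 𝓘(ℝ, EuclideanSpace ℝ (Fin n)) ((𝓡 n).prod 𝓘(ℝ, ℝ)) ∞
      (fun y ↦ TotalSpace.mk' ℝ (E := Bundle.Trivial Q ℝ) ((extChartAt (𝓡 n) x₀).symm y) (f y))
      (extChartAt (𝓡 n) x₀).target) : ContDiffOn ℝ ∞ f (extChartAt (𝓡 n) x₀).target := by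
  rw [← contMDiffOn_iff_contDiffOn]
  intro y hy
  have := h y hy
  rw [contMDiffWithinAt_totalSpace] at this
  simpa using this.2

theorem isMetricOn_metricCoord (g : Metric n Q) (x₀ : Q) :
    IsMetricOn (extChartAt (𝓡 n) x₀).target (metricCoord g x₀) where
  isOpen := isOpen_extChartAt_target x₀
  smooth := by
    rw [contDiffOn_clm_apply]
    intro u
    rw [contDiffOn_clm_apply]
    intro v
    apply contDiffOn_of_totalSpace (x₀ := x₀)
    exact ContMDiffOn.clm_bundle_apply₂
      (g.contMDiff.comp_contMDiffOn (contMDiffOn_extChartAt_symm x₀))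
      (contMDiffOn_ofCoord x₀ u) (contMDiffOn_ofCoord x₀ v)
  symm y hy u v := by
    rw [metricCoord_eq g hy, metricCoord_eq g hy]
    exact g.symm _ _ _
  pos y hy v hv := by
    rw [metricCoord_eq g hy]
    refine g.pos _ _ fun h ↦ hv ?_
    rw [← coframe_frame ((extChartAt (𝓡 n) x₀).map_target hy) v]
    have h' : frame x₀ ((extChartAt (𝓡 n) x₀).symm y) v = 0 := h
    rw [h', map_zero]

theorem contDiffOn_formCoord {μ : OneForm n Q} (hμ : μ.IsSmooth) (x₀ : Q) :
    ContDiffOn ℝ ∞ (formCoord μ x₀) (extChartAt (𝓡 n) x₀).target := by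
  rw [contDiffOn_clm_apply]
  intro u
  apply contDiffOn_of_totalSpace (x₀ := x₀)
  exact ContMDiffOn.clm_bundle_apply
    (ContMDiff.comp_contMDiffOn (g := fun q ↦ (⟨q, μ q⟩ : TotalSpace _
      (fun q : Q ↦ TangentSpace (𝓡 n) q →L[ℝ] Bundle.Trivial Q ℝ q))) hμ
      (contMDiffOn_extChartAt_symm x₀)) (contMDiffOn_ofCoord x₀ u)

end Chart

/-! ### Covariant derivatives along a curve in a chart -/

section OneVariable

variable {E : Type*} [NormedAddCommGroup E] [NormedSpace ℝ E]

theorem hasDerivWithinAt_of_contDiffOn_inter {S O : Set ℝ} (hO : IsOpen O) {f : ℝ → E}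
    (hf : ContDiffOn ℝ ∞ f (S ∩ O)) {t : ℝ} (ht : t ∈ S ∩ O) :
    HasDerivWithinAt f (derivWithin f S t) S t :=
  ((((hf t ht).differentiableWithinAt (by simp)).mono_of_mem_nhdsWithin
    (Filter.inter_mem self_mem_nhdsWithin (mem_nhdsWithin_of_mem_nhds (hO.mem_nhds ht.2))))
    ).hasDerivWithinAt

theorem contDiffOn_derivWithin_inter {S O : Set ℝ} (hS : UniqueDiffOn ℝ S) (hO : IsOpen O)
    {f : ℝ → E} (hf : ContDiffOn ℝ ∞ f (S ∩ O)) : ContDiffOn ℝ ∞ (derivWithin f S) (S ∩ O) := by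
  refine (hf.derivWithin (hS.inter hO) (m := ∞) (by simp)).congr fun t ht ↦ ?_
  exact (derivWithin_inter (hO.mem_nhds ht.2)).symm

/-- The covariant derivative within `S`, for the metric `G`, of the field `w` along the curve `x`
in a vector space. -/
def covDeriv (G : E → E →L[ℝ] E →L[ℝ] ℝ) (S : Set ℝ) (x w : ℝ → E) (t : ℝ) : E :=
  derivWithin w S t + chrL G (x t) (derivWithin x S t) (w t)

variable {G : E → E →L[ℝ] E →L[ℝ] ℝ} {S O : Set ℝ} {x : ℝ → E} {t : ℝ}

theorem covDeriv_congr {w w' : ℝ → E} (h : ∀ t ∈ S ∩ O, w t = w' t) (hO : IsOpen O)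
    (ht : t ∈ S ∩ O) : covDeriv G S x w t = covDeriv G S x w' t := by
  have he : w =ᶠ[𝓝[S] t] w' := by
    filter_upwards [self_mem_nhdsWithin, mem_nhdsWithin_of_mem_nhds (hO.mem_nhds ht.2)] with τ h1 h2
      using h τ ⟨h1, h2⟩
  rw [covDeriv, covDeriv, he.derivWithin_eq (h t ht), h t ht]

theorem covDeriv_add {w w' : ℝ → E} (hw : DifferentiableWithinAt ℝ w S t)
    (hw' : DifferentiableWithinAt ℝ w' S t) :
    covDeriv G S x (fun t ↦ w t + w' t) t = covDeriv G S x w t + covDeriv G S x w' t := by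
  simp only [covDeriv, derivWithin_fun_add hw hw', map_add]
  abel

theorem covDeriv_sum {ι : Type*} {s : Finset ι} {w : ι → ℝ → E}
    (hw : ∀ i ∈ s, DifferentiableWithinAt ℝ (w i) S t) :
    covDeriv G S x (fun t ↦ ∑ i ∈ s, w i t) t = ∑ i ∈ s, covDeriv G S x (w i) t := by
  simp only [covDeriv, derivWithin_fun_sum hw, map_sum, Finset.sum_add_distrib]

theorem covDeriv_smul {f : ℝ → ℝ} {w : ℝ → E} (hf : DifferentiableWithinAt ℝ f S t)
    (hw : DifferentiableWithinAt ℝ w S t) :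
    covDeriv G S x (fun t ↦ f t • w t) t =
      derivWithin f S t • w t + f t • covDeriv G S x w t := by
  simp only [covDeriv, derivWithin_fun_smul hf hw, map_smul, smul_add]
  abel

theorem contDiffOn_covDeriv [FiniteDimensional ℝ E] {U : Set E} (hG : IsMetricOn U G)
    (hS : UniqueDiffOn ℝ S) (hO : IsOpen O) (hx : ContDiffOn ℝ ∞ x (S ∩ O))
    (hxU : MapsTo x (S ∩ O) U) {w : ℝ → E} (hw : ContDiffOn ℝ ∞ w (S ∩ O)) :
    ContDiffOn ℝ ∞ (covDeriv G S x w) (S ∩ O) := by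
  have h1 : ContDiffOn ℝ ∞ (fun t ↦ chrL G (x t)) (S ∩ O) := fun t ht ↦
    (hG.contDiffAt_chrL (hxU ht)).comp_contDiffWithinAt t (hx t ht)
  exact (contDiffOn_derivWithin_inter hS hO hw).add
    ((h1.clm_apply (contDiffOn_derivWithin_inter hS hO hx)).clm_apply hw)

/-- The second covariant derivative of `A + ∑ f_i Y_i`, by the Leibniz rule. -/
theorem covDeriv_covDeriv_add_sum_smul [FiniteDimensional ℝ E] {U : Set E} (hG : IsMetricOn U G)
    (hS : UniqueDiffOn ℝ S) (hO : IsOpen O) (hx : ContDiffOn ℝ ∞ x (S ∩ O))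
    (hxU : MapsTo x (S ∩ O) U) {ι : Type*} [Fintype ι] {A : ℝ → E} {f : ι → ℝ → ℝ} {Y : ι → ℝ → E}
    (hA : ContDiffOn ℝ ∞ A (S ∩ O)) (hf : ∀ i, ContDiffOn ℝ ∞ (f i) (S ∩ O))
    (hY : ∀ i, ContDiffOn ℝ ∞ (Y i) (S ∩ O)) (ht : t ∈ S ∩ O) :
    covDeriv G S x (covDeriv G S x (fun t ↦ A t + ∑ i, f i t • Y i t)) t =
      covDeriv G S x (covDeriv G S x A) t
        + ∑ i, (derivWithin (derivWithin (f i) S) S t • Y i t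
          + (2 * derivWithin (f i) S t) • covDeriv G S x (Y i) t
          + f i t • covDeriv G S x (covDeriv G S x (Y i)) t) := by
  have d : ∀ {F : Type _} [NormedAddCommGroup F] [NormedSpace ℝ F] {f : ℝ → F},
      ContDiffOn ℝ ∞ f (S ∩ O) → ∀ t ∈ S ∩ O, DifferentiableWithinAt ℝ f S t := fun hf t ht ↦
    (hasDerivWithinAt_of_contDiffOn_inter hO hf ht).differentiableWithinAt
  have e : ∀ {f : ℝ → ℝ}, ContDiffOn ℝ ∞ f (S ∩ O) → ∀ t ∈ S ∩ O, DifferentiableWithinAt ℝ f S t :=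
    fun hf t ht ↦ (hasDerivWithinAt_of_contDiffOn_inter hO hf ht).differentiableWithinAt
  have hf' := fun i ↦ contDiffOn_derivWithin_inter hS hO (hf i)
  have hA' := contDiffOn_covDeriv hG hS hO hx hxU hA
  have hY' := fun i ↦ contDiffOn_covDeriv hG hS hO hx hxU (hY i)
  have h1 : ∀ t ∈ S ∩ O, covDeriv G S x (fun t ↦ A t + ∑ i, f i t • Y i t) t =
      covDeriv G S x A t
        + ∑ i, (derivWithin (f i) S t • Y i t + f i t • covDeriv G S x (Y i) t) := by
    intro t ht
    have hi : ∀ i ∈ Finset.univ, DifferentiableWithinAt ℝ (fun t ↦ f i t • Y i t) S t :=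
      fun i _ ↦ d ((hf i).smul (hY i)) t ht
    rw [covDeriv_add (d hA t ht) (DifferentiableWithinAt.fun_sum hi), covDeriv_sum hi]
    congr 1
    exact Finset.sum_congr rfl fun i _ ↦ covDeriv_smul (e (hf i) t ht) (d (hY i) t ht)
  have hi1 : ∀ i, DifferentiableWithinAt ℝ (fun t ↦ derivWithin (f i) S t • Y i t) S t :=
    fun i ↦ d ((hf' i).smul (hY i)) t ht
  have hi2 : ∀ i, DifferentiableWithinAt ℝ (fun t ↦ f i t • covDeriv G S x (Y i) t) S t :=
    fun i ↦ d ((hf i).smul (hY' i)) t ht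
  have hi : ∀ i ∈ Finset.univ, DifferentiableWithinAt ℝ
      (fun t ↦ derivWithin (f i) S t • Y i t + f i t • covDeriv G S x (Y i) t) S t :=
    fun i _ ↦ (hi1 i).add (hi2 i)
  rw [covDeriv_congr h1 hO ht, covDeriv_add (d hA' t ht) (DifferentiableWithinAt.fun_sum hi),
    covDeriv_sum hi]
  congr 1
  refine Finset.sum_congr rfl fun i _ ↦ ?_
  rw [covDeriv_add (hi1 i) (hi2 i),
    covDeriv_smul (e (hf' i) t ht) (d (hY i) t ht), covDeriv_smul (e (hf i) t ht) (d (hY' i) t ht)]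
  module

end OneVariable

section AlongCurve

variable {n m : ℕ} {Q : Type*} [TopologicalSpace Q] [ChartedSpace (EuclideanSpace ℝ (Fin n)) Q]
  [IsManifold (𝓡 n) ∞ Q]

/-- Coordinate changes are smooth, and their derivative re-expresses tangent vectors. -/
theorem contDiffAt_transition_and_fderiv {x₀ q p : Q} (h0 : p ∈ (extChartAt (𝓡 n) x₀).source)
    (hq : p ∈ (extChartAt (𝓡 n) q).source) :
    ContDiffAt ℝ ∞ (extChartAt (𝓡 n) q ∘ (extChartAt (𝓡 n) x₀).symm) (extChartAt (𝓡 n) x₀ p) ∧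
    fderiv ℝ (extChartAt (𝓡 n) q ∘ (extChartAt (𝓡 n) x₀).symm) (extChartAt (𝓡 n) x₀ p) =
      (coframe q p).comp (frame x₀ p) := by
  have hl := (extChartAt (𝓡 n) x₀).left_inv h0
  have ht := (extChartAt (𝓡 n) x₀).map_source h0
  have hopen := (isOpen_extChartAt_target (I := 𝓡 n) x₀).mem_nhds ht
  have h1 : ContMDiffAt 𝓘(ℝ, EuclideanSpace ℝ (Fin n)) (𝓡 n) ∞ (extChartAt (𝓡 n) x₀).symm
      (extChartAt (𝓡 n) x₀ p) := (contMDiffOn_extChartAt_symm x₀).contMDiffAt hopen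
  have h2 : ContMDiffAt (𝓡 n) 𝓘(ℝ, EuclideanSpace ℝ (Fin n)) ∞ (extChartAt (𝓡 n) q)
      ((extChartAt (𝓡 n) x₀).symm (extChartAt (𝓡 n) x₀ p)) := by
    rw [hl]
    exact contMDiffAt_extChartAt' (by simpa using hq)
  refine ⟨(h2.comp _ h1).contDiffAt, ?_⟩
  have h3 := mfderiv_comp (extChartAt (𝓡 n) x₀ p) (h2.mdifferentiableAt (by simp))
    (h1.mdifferentiableAt (by simp))
  rw [← mfderiv_eq_fderiv, h3]
  have h4 : (coframe (n := n) q ((extChartAt (𝓡 n) x₀).symm (extChartAt (𝓡 n) x₀ p))).comp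
      (frame x₀ p) = (coframe q p).comp (frame x₀ p) := by rw [hl]
  exact h4

theorem velocity_eq {T : ℝ} (hT : 0 < T) {c : ℝ → Q} {x₀ : Q} {t : ℝ} (ht : t ∈ Icc 0 T)
    (hc : MDifferentiableWithinAt 𝓘(ℝ, ℝ) (𝓡 n) c (Icc 0 T) t)
    (hs : c t ∈ (extChartAt (𝓡 n) x₀).source) :
    velocity n T c t =
      frame x₀ (c t) (derivWithin (fun τ ↦ extChartAt (𝓡 n) x₀ (c τ)) (Icc 0 T) t) := by
  have hu : UniqueMDiffWithinAt 𝓘(ℝ, ℝ) (Icc 0 T) t :=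
    ((uniqueDiffOn_Icc hT) t ht).uniqueMDiffWithinAt
  have h2 : MDifferentiableAt (𝓡 n) 𝓘(ℝ, EuclideanSpace ℝ (Fin n)) (extChartAt (𝓡 n) x₀) (c t) :=
    mdifferentiableAt_extChartAt (by simpa using hs)
  have h3 := mfderiv_comp_mfderivWithin t h2 hc hu
  rw [mfderivWithin_eq_fderivWithin] at h3
  have h4 : derivWithin (fun τ ↦ extChartAt (𝓡 n) x₀ (c τ)) (Icc 0 T) t =
      coframe x₀ (c t) (velocity n T c t) := by
    exact congrArg (fun L : ℝ →L[ℝ] EuclideanSpace ℝ (Fin n) ↦ L 1) h3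
  rw [h4]
  exact (frame_coframe hs (velocity n T c t)).symm

/-- The covariant derivative along a curve, computed in any chart. -/
theorem covD_eq (g : Metric n Q) {T : ℝ} (hT : 0 < T) {c : ℝ → Q} {x₀ : Q} {t : ℝ}
    (ht : t ∈ Icc 0 T) (hc : MDifferentiableWithinAt 𝓘(ℝ, ℝ) (𝓡 n) c (Icc 0 T) t)
    (hs : c t ∈ (extChartAt (𝓡 n) x₀).source)
    {W : (t : ℝ) → TangentSpace (𝓡 n) (c t)} {w : ℝ → EuclideanSpace ℝ (Fin n)}
    (hW : ∀ᶠ τ in 𝓝[Icc 0 T] t, W τ = frame x₀ (c τ) (w τ))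
    (hw : DifferentiableWithinAt ℝ w (Icc 0 T) t) :
    covD g T c W t = frame x₀ (c t) (covDeriv (metricCoord g x₀) (Icc 0 T)
      (fun τ ↦ extChartAt (𝓡 n) x₀ (c τ)) w t) := by
  set q := c t with hq
  set x : ℝ → EuclideanSpace ℝ (Fin n) := fun τ ↦ extChartAt (𝓡 n) x₀ (c τ) with hx
  set ψ := extChartAt (𝓡 n) q ∘ (extChartAt (𝓡 n) x₀).symm with hψ
  have hqq : q ∈ (extChartAt (𝓡 n) q).source := mem_extChartAt_source q
  have hWt : W t = frame x₀ q (w t) := hW.self_of_nhdsWithin ht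
  obtain ⟨hψs, hψd⟩ := contDiffAt_transition_and_fderiv hs hqq
  have hxt : x t = extChartAt (𝓡 n) x₀ q := rfl
  have hcont := hc.continuousWithinAt
  -- the components of `W` in the chart at `c t`, through the transition map
  have hcomp : (fun τ ↦ coframe q (c τ) (W τ)) =ᶠ[𝓝[Icc 0 T] t]
      fun τ ↦ fderiv ℝ ψ (x τ) (w τ) := by
    have e1 := hcont.eventually_mem ((isOpen_extChartAt_source (I := 𝓡 n) x₀).mem_nhds hs)
    have e2 := hcont.eventually_mem ((isOpen_extChartAt_source (I := 𝓡 n) q).mem_nhds hqq)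
    filter_upwards [hW, e1, e2] with τ h1 h2 h3
    rw [h1, (contDiffAt_transition_and_fderiv h2 h3).2]
    rfl
  have hxd : HasDerivWithinAt x (derivWithin x (Icc 0 T) t) (Icc 0 T) t := by
    refine DifferentiableWithinAt.hasDerivWithinAt ?_
    have h2 : MDifferentiableAt (𝓡 n) 𝓘(ℝ, EuclideanSpace ℝ (Fin n)) (extChartAt (𝓡 n) x₀) (c t) :=
      mdifferentiableAt_extChartAt (by simpa using hs)
    exact (h2.comp_mdifferentiableWithinAt t hc).differentiableWithinAt
  have hψ2 : HasFDerivAt (fderiv ℝ ψ) (fderiv ℝ (fderiv ℝ ψ) (x t)) (x t) :=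
    ((hψs.fderiv_right (m := ∞) (by simp)).differentiableAt (by simp)).hasFDerivAt
  have hd := (hψ2.comp_hasDerivWithinAt t hxd).clm_apply hw.hasDerivWithinAt
  have hd' := (hd.congr_of_eventuallyEq hcomp (hcomp.self_of_nhdsWithin ht)).derivWithin
    ((uniqueDiffOn_Icc hT) t ht)
  have hvel : coframe q q (velocity n T c t) = fderiv ℝ ψ (x t) (derivWithin x (Icc 0 T) t) := by
    rw [velocity_eq hT ht hc hs, hxt, hψd]
    rfl
  have hwt : coframe q q (W t) = fderiv ℝ ψ (x t) (w t) := by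
    rw [hWt, hxt, hψd]
    rfl
  have hψx : ψ (x t) = extChartAt (𝓡 n) q q := by
    rw [hψ, hxt, Function.comp_apply, (extChartAt (𝓡 n) x₀).left_inv hs]
  have hpull : ∀ᶠ z in 𝓝 (x t), ∀ a b, metricCoord g x₀ z a b =
      metricCoord g q (ψ z) (fderiv ℝ ψ z a) (fderiv ℝ ψ z b) := by
    have htg := (extChartAt (𝓡 n) x₀).map_source hs
    have hcs : ContinuousAt (extChartAt (𝓡 n) x₀).symm (x t) :=
      (continuousOn_extChartAt_symm x₀).continuousAt
        ((isOpen_extChartAt_target (I := 𝓡 n) x₀).mem_nhds htg)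
    have e2 := hcs.eventually_mem ((isOpen_extChartAt_source (I := 𝓡 n) q).mem_nhds
      (by rw [hxt, (extChartAt (𝓡 n) x₀).left_inv hs]; exact hqq))
    filter_upwards [(isOpen_extChartAt_target (I := 𝓡 n) x₀).mem_nhds htg, e2] with z h1 h2 a b
    obtain ⟨p, hp, rfl⟩ : ∃ p ∈ (extChartAt (𝓡 n) x₀).source, extChartAt (𝓡 n) x₀ p = z :=
      ⟨_, (extChartAt (𝓡 n) x₀).map_target h1, (extChartAt (𝓡 n) x₀).right_inv h1⟩
    rw [(extChartAt (𝓡 n) x₀).left_inv hp] at h2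
    rw [(contDiffAt_transition_and_fderiv hp h2).2, metricCoord_extChartAt g hp]
    simp only [hψ, Function.comp_apply, (extChartAt (𝓡 n) x₀).left_inv hp]
    rw [metricCoord_extChartAt g h2]
    simp only [ContinuousLinearMap.comp_apply, frame_coframe h2]
  have hsurj : Function.Surjective (fderiv ℝ ψ (x t)) := fun w ↦
    ⟨coframe x₀ q w, by
      rw [hxt, hψd, coframe_self, ContinuousLinearMap.comp_apply, frame_coframe hs]; rfl⟩
  have hΓ := (isMetricOn_metricCoord g x₀).fderiv_apply_chrL (isMetricOn_metricCoord g q)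
    ((extChartAt (𝓡 n) x₀).map_source hs) hψs
    (by rw [← hψ, ← hxt, hψx]; exact (extChartAt (𝓡 n) q).map_source hqq) hsurj hpull
    (derivWithin x (Icc 0 T) t) (w t)
  have hmain : covD g T c W t = derivWithin (fun τ ↦ coframe q (c τ) (W τ)) (Icc 0 T) t
      + chrL (metricCoord g q) (extChartAt (𝓡 n) q q) (coframe q q (velocity n T c t))
        (coframe q q (W t)) := fromCoordAt_eq _ _
  have hfr : ∀ u, frame x₀ q u = fderiv ℝ ψ (x t) u := fun u ↦ by
    rw [hxt, hψd, coframe_self]; rfl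
  rw [hmain, hd', hvel, hwt, hfr, covDeriv, map_add]
  rw [← hxt, ← hψ, hψx] at hΓ
  rw [hΓ]
  simp only [Function.comp_apply]
  abel

end AlongCurve

/-! ### The augmented functional in a chart -/

section Integrand

variable {n m : ℕ} {Q : Type*} [TopologicalSpace Q] [ChartedSpace (EuclideanSpace ℝ (Fin n)) Q]

/-- On the relatively open part `[0, T] ∩ O` of its domain, the curve `c` is smooth and stays in
the domain of the chart at `x₀`. -/
structure InChart (n : ℕ) {Q : Type*} [TopologicalSpace Q]
    [ChartedSpace (EuclideanSpace ℝ (Fin n)) Q] (T : ℝ) (c : ℝ → Q) (x₀ : Q) (O : Set ℝ) :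
    Prop where
  isOpen : IsOpen O
  mem : ∀ t ∈ Icc 0 T ∩ O, c t ∈ (extChartAt (𝓡 n) x₀).source
  smooth : ContMDiffOn 𝓘(ℝ, ℝ) (𝓡 n) ∞ c (Icc 0 T ∩ O)

/-- The integrand of the augmented functional. -/
def integrand [IsManifold (𝓡 n) ∞ Q] (g : Metric n Q) (μ : Fin m → OneForm n Q) (V : Q → ℝ)
    (σ T : ℝ) (c : ℝ → Q) (lam : Fin m → ℝ → ℝ) (t : ℝ) : ℝ :=
  (1 / 2 : ℝ) * (g.inner (c t) (accel g T c t) (accel g T c t)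
        + σ * g.inner (c t) (velocity n T c t) (velocity n T c t) + V (c t))
      + ∑ a, lam a t * μ a (c t) (accel g T c t)

variable [IsManifold (𝓡 n) ∞ Q] {T : ℝ} {c : ℝ → Q} {x₀ : Q} {O : Set ℝ} {t : ℝ}

/-- The musical isomorphism in a chart. -/
theorem sharp_eq (g : Metric n Q) {q : Q} (hq : q ∈ (extChartAt (𝓡 n) x₀).source)
    (α : EuclideanSpace ℝ (Fin n) →L[ℝ] ℝ) :
    sharp g q α = frame x₀ q
      ((metricCoord g x₀ (extChartAt (𝓡 n) x₀ q)).inverse (α.comp (frame x₀ q))) := by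
  have hpos : ∀ v, v ≠ 0 → 0 < innerModel g q v v := fun v hv ↦ g.pos q v hv
  refine eq_of_forall_apply_eq (u := (sharp g q α : EuclideanSpace ℝ (Fin n))) hpos fun w ↦ ?_
  have h1 : innerModel g q (sharp g q α : EuclideanSpace ℝ (Fin n)) w = α w := inner_sharp g q α w
  rw [h1]
  conv_rhs => rw [← frame_coframe hq w]
  rw [← metricCoord_extChartAt g hq, ((isMetricOn_metricCoord g x₀).isInvertible
    ((extChartAt (𝓡 n) x₀).map_source hq)).self_apply_inverse, ContinuousLinearMap.comp_apply,
    frame_coframe hq]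

namespace InChart

section
omit [IsManifold (𝓡 n) ∞ Q]

theorem mdifferentiableWithinAt (h : InChart n T c x₀ O) (ht : t ∈ Icc 0 T ∩ O) :
    MDifferentiableWithinAt 𝓘(ℝ, ℝ) (𝓡 n) c (Icc 0 T) t :=
  ((h.smooth t ht).mdifferentiableWithinAt (by simp)).mono_of_mem_nhdsWithin
    (Filter.inter_mem self_mem_nhdsWithin (mem_nhdsWithin_of_mem_nhds (h.isOpen.mem_nhds ht.2)))

theorem eventually (h : InChart n T c x₀ O) (ht : t ∈ Icc 0 T ∩ O) {p : ℝ → Prop}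
    (hp : ∀ τ ∈ Icc 0 T ∩ O, p τ) : ∀ᶠ τ in 𝓝[Icc 0 T] t, p τ := by
  filter_upwards [self_mem_nhdsWithin, mem_nhdsWithin_of_mem_nhds (h.isOpen.mem_nhds ht.2)]
    with τ h1 h2 using hp τ ⟨h1, h2⟩

theorem mapsTo (h : InChart n T c x₀ O) : MapsTo (fun τ ↦ extChartAt (𝓡 n) x₀ (c τ))
    (Icc 0 T ∩ O) (extChartAt (𝓡 n) x₀).target := fun t ht ↦
  (extChartAt (𝓡 n) x₀).map_source (h.mem t ht)

end

theorem contDiffOn (h : InChart n T c x₀ O) :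
    ContDiffOn ℝ ∞ (fun τ ↦ extChartAt (𝓡 n) x₀ (c τ)) (Icc 0 T ∩ O) := by
  rw [← contMDiffOn_iff_contDiffOn]
  exact (contMDiffOn_extChartAt (n := ∞)).comp h.smooth
    fun t ht ↦ by simpa using h.mem t ht

theorem covD_eq (hT : 0 < T) (h : InChart n T c x₀ O) (g : Metric n Q)
    {W : (t : ℝ) → TangentSpace (𝓡 n) (c t)} {w : ℝ → EuclideanSpace ℝ (Fin n)}
    (hW : ∀ t ∈ Icc 0 T ∩ O, W t = frame x₀ (c t) (w t)) (hw : ContDiffOn ℝ ∞ w (Icc 0 T ∩ O)) :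
    ∀ t ∈ Icc 0 T ∩ O, covD g T c W t = frame x₀ (c t) (covDeriv (metricCoord g x₀) (Icc 0 T)
      (fun τ ↦ extChartAt (𝓡 n) x₀ (c τ)) w t) := fun t ht ↦
  ConstrainedAcceleration.covD_eq g hT ht.1 (h.mdifferentiableWithinAt ht) (h.mem t ht)
    (h.eventually ht hW)
    (hasDerivWithinAt_of_contDiffOn_inter h.isOpen hw ht).differentiableWithinAt

theorem contDiffOn_covDeriv (hT : 0 < T) (h : InChart n T c x₀ O) (g : Metric n Q)
    {w : ℝ → EuclideanSpace ℝ (Fin n)} (hw : ContDiffOn ℝ ∞ w (Icc 0 T ∩ O)) :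
    ContDiffOn ℝ ∞ (covDeriv (metricCoord g x₀) (Icc 0 T)
      (fun τ ↦ extChartAt (𝓡 n) x₀ (c τ)) w) (Icc 0 T ∩ O) :=
  ConstrainedAcceleration.contDiffOn_covDeriv (isMetricOn_metricCoord g x₀) (uniqueDiffOn_Icc hT)
    h.isOpen h.contDiffOn h.mapsTo hw

theorem contDiffOn_deriv (hT : 0 < T) (h : InChart n T c x₀ O) :
    ContDiffOn ℝ ∞ (derivWithin (fun τ ↦ extChartAt (𝓡 n) x₀ (c τ)) (Icc 0 T)) (Icc 0 T ∩ O) :=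
  contDiffOn_derivWithin_inter (uniqueDiffOn_Icc hT) h.isOpen h.contDiffOn

theorem velocity_eq (hT : 0 < T) (h : InChart n T c x₀ O) : ∀ t ∈ Icc 0 T ∩ O,
    velocity n T c t =
      frame x₀ (c t) (derivWithin (fun τ ↦ extChartAt (𝓡 n) x₀ (c τ)) (Icc 0 T) t) := fun t ht ↦
  ConstrainedAcceleration.velocity_eq hT ht.1 (h.mdifferentiableWithinAt ht) (h.mem t ht)

theorem accel_eq (hT : 0 < T) (h : InChart n T c x₀ O) (g : Metric n Q) : ∀ t ∈ Icc 0 T ∩ O,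
    accel g T c t = frame x₀ (c t) (covDeriv (metricCoord g x₀) (Icc 0 T)
      (fun τ ↦ extChartAt (𝓡 n) x₀ (c τ))
      (derivWithin (fun τ ↦ extChartAt (𝓡 n) x₀ (c τ)) (Icc 0 T)) t) :=
  h.covD_eq hT g (h.velocity_eq hT) (h.contDiffOn_deriv hT)

theorem integrand_eq (hT : 0 < T) (h : InChart n T c x₀ O) (g : Metric n Q)
    (μ : Fin m → OneForm n Q) (V : Q → ℝ) (σ : ℝ) (lam : Fin m → ℝ → ℝ) (ht : t ∈ Icc 0 T ∩ O) :
    integrand g μ V σ T c lam t = lagrangian (metricCoord g x₀) (fun a ↦ formCoord (μ a) x₀)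
      (fun y ↦ V ((extChartAt (𝓡 n) x₀).symm y)) σ (extChartAt (𝓡 n) x₀ (c t))
      (derivWithin (fun τ ↦ extChartAt (𝓡 n) x₀ (c τ)) (Icc 0 T) t)
      (derivWithin (derivWithin (fun τ ↦ extChartAt (𝓡 n) x₀ (c τ)) (Icc 0 T)) (Icc 0 T) t)
      (fun a ↦ lam a t) := by
  have hs := h.mem t ht
  have h0 : integrand g μ V σ T c lam t = (1 / 2 : ℝ) *
      (innerModel g (c t) (accel g T c t : EuclideanSpace ℝ (Fin n))
          (accel g T c t : EuclideanSpace ℝ (Fin n))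
        + σ * innerModel g (c t) (velocity n T c t : EuclideanSpace ℝ (Fin n))
          (velocity n T c t : EuclideanSpace ℝ (Fin n)) + V (c t))
      + ∑ a, lam a t * formModel (μ a) (c t) (accel g T c t : EuclideanSpace ℝ (Fin n)) := rfl
  rw [h0, h.velocity_eq hT t ht, h.accel_eq hT g t ht]
  simp only [← metricCoord_extChartAt g hs, ← formCoord_extChartAt _ hs]
  rw [lagrangian, (extChartAt (𝓡 n) x₀).left_inv hs]
  rfl

end InChart

theorem contDiffOn_potential {V : Q → ℝ} (hV : ContMDiff (𝓡 n) 𝓘(ℝ, ℝ) ∞ V) (x₀ : Q) :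
    ContDiffOn ℝ ∞ (fun y ↦ V ((extChartAt (𝓡 n) x₀).symm y)) (extChartAt (𝓡 n) x₀).target := by
  rw [← contMDiffOn_iff_contDiffOn]
  exact hV.comp_contMDiffOn (contMDiffOn_extChartAt_symm x₀)

theorem integrableOn_integrand_Ioo (hT : 0 < T) (g : Metric n Q) {μ : Fin m → OneForm n Q}
    (hμ : ∀ a, (μ a).IsSmooth) {V : Q → ℝ} (hV : ContMDiff (𝓡 n) 𝓘(ℝ, ℝ) ∞ V) (σ : ℝ)
    {lam : Fin m → ℝ → ℝ} {a b : ℝ} (ha : 0 ≤ a) (hb : b ≤ T)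
    (hc : ContMDiffOn 𝓘(ℝ, ℝ) (𝓡 n) ∞ c (Icc a b))
    (hcs : ∀ t ∈ Icc a b, c t ∈ (extChartAt (𝓡 n) x₀).source)
    (hlam : ∀ i, ContDiffOn ℝ ∞ (lam i) (Icc a b)) :
    IntegrableOn (integrand g μ V σ T c lam) (Ioo a b) := by
  rcases le_or_gt b a with hab | hab
  · simp [Ioo_eq_empty_of_le hab]
  have hu := uniqueDiffOn_Icc hab
  have hch : InChart n T c x₀ (Ioo a b) :=
    ⟨isOpen_Ioo, fun t ht ↦ hcs t (Ioo_subset_Icc_self ht.2),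
      hc.mono fun t ht ↦ Ioo_subset_Icc_self ht.2⟩
  set x : ℝ → EuclideanSpace ℝ (Fin n) := fun τ ↦ extChartAt (𝓡 n) x₀ (c τ) with hx
  have cx : ContDiffOn ℝ ∞ x (Icc a b) := by
    rw [← contMDiffOn_iff_contDiffOn]
    exact (contMDiffOn_extChartAt (n := ∞)).comp hc fun t ht ↦ by simpa using hcs t ht
  have cv : ContDiffOn ℝ ∞ (derivWithin x (Icc a b)) (Icc a b) := cx.derivWithin hu (by simp)
  have cz : ContDiffOn ℝ ∞ (derivWithin (derivWithin x (Icc a b)) (Icc a b)) (Icc a b) :=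
    cv.derivWithin hu (by simp)
  have hcont := continuousOn_lagrangian (σ := σ) (l := fun t i ↦ lam i t)
    (isMetricOn_metricCoord g x₀)
    (fun i ↦ contDiffOn_formCoord (hμ i) x₀) (contDiffOn_potential hV x₀)
    (fun t ht ↦ (extChartAt (𝓡 n) x₀).map_source (hcs t ht)) cx.continuousOn cv.continuousOn
    cz.continuousOn (fun i ↦ (hlam i).continuousOn)
  have hint := (hcont.integrableOn_Icc (μ := volume)).mono_set
    (Ioo_subset_Icc_self (a := a) (b := b))
  refine hint.congr_fun (fun t ht ↦ ?_) measurableSet_Ioo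
  have hd : ∀ τ ∈ Ioo a b, ∀ f : ℝ → EuclideanSpace ℝ (Fin n),
      derivWithin f (Icc 0 T) τ = derivWithin f (Icc a b) τ := fun τ hτ f ↦ by
    rw [derivWithin_of_mem_nhds (Icc_mem_nhds hτ.1 hτ.2),
      derivWithin_of_mem_nhds (Icc_mem_nhds (ha.trans_lt hτ.1) (hτ.2.trans_le hb))]
  have hev : derivWithin x (Icc 0 T) =ᶠ[𝓝[Icc 0 T] t] derivWithin x (Icc a b) :=
    mem_nhdsWithin_of_mem_nhds (Filter.mem_of_superset (isOpen_Ioo.mem_nhds ht)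
      fun τ hτ ↦ hd τ hτ x)
  have ht' : t ∈ Icc 0 T ∩ Ioo a b := ⟨⟨ha.trans ht.1.le, ht.2.le.trans hb⟩, ht⟩
  simp only
  rw [hch.integrand_eq hT g μ V σ lam ht', hev.derivWithin_eq (hd t ht x), hd t ht, hd t ht]

omit [IsManifold (𝓡 n) ∞ Q] in
/-- Near a point of `[0, T]`, a continuous curve stays in the chart at its value there, and the
finite set `P` contains no other point. -/
theorem exists_Icc_subset_chart (hc : ContinuousOn c (Icc 0 T)) (P : Finset ℝ) (ht : t ∈ Icc 0 T) :
    ∃ η > 0, ∀ τ ∈ Icc (t - η) (t + η),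
      (τ ∈ Icc 0 T → c τ ∈ (extChartAt (𝓡 n) (c t)).source) ∧ (τ ∈ P → τ = t) := by
  have h1 : ∀ᶠ τ in 𝓝[Icc 0 T] t, c τ ∈ (extChartAt (𝓡 n) (c t)).source :=
    (hc t ht).eventually_mem (extChartAt_source_mem_nhds (I := 𝓡 n) (c t))
  rw [eventually_nhdsWithin_iff] at h1
  have h2 : ∀ᶠ τ in 𝓝 t, τ ∈ P → τ = t := by
    have := (P.erase t).finite_toSet.isClosed.isOpen_compl.mem_nhds (x := t) (by simp)
    filter_upwards [this] with τ hτ hP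
    by_contra hne
    exact hτ (by simp [hne, hP])
  obtain ⟨ε, hε, hball⟩ := Metric.eventually_nhds_iff_ball.1 (h1.and h2)
  refine ⟨ε / 2, by positivity, fun τ hτ ↦ hball τ ?_⟩
  rw [Metric.mem_ball, Real.dist_eq, abs_lt]
  constructor <;> linarith [hτ.1, hτ.2]

/-- The integrand of the augmented functional is integrable along the curves of `Ω`. -/
theorem integrableOn_integrand (hT : 0 < T) (g : Metric n Q) {μ : Fin m → OneForm n Q}
    (hμ : ∀ a, (μ a).IsSmooth) {V : Q → ℝ} (hV : ContMDiff (𝓡 n) 𝓘(ℝ, ℝ) ∞ V) (σ : ℝ)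
    {lam : Fin m → ℝ → ℝ} {P : Finset ℝ} (hcont : ContinuousOn c (Icc 0 T))
    (hc : SmoothOffCurve n T P c) (hlam : SmoothOffFun T P lam) :
    IntegrableOn (integrand g μ V σ T c lam) (Icc 0 T) := by
  refine LocallyIntegrableOn.integrableOn_isCompact (fun t ht ↦ ?_) isCompact_Icc
  obtain ⟨η, hη, hη'⟩ := exists_Icc_subset_chart (n := n) hcont P ht
  have key : ∀ a b, 0 ≤ a → b ≤ T → Icc a b ⊆ Icc (t - η) (t + η) → t ∉ Ioo a b →
      IntegrableOn (integrand g μ V σ T c lam) (Ioo a b) := by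
    intro a b ha hb hsub htab
    rcases le_or_gt b a with hab | hab
    · simp [Ioo_eq_empty_of_le hab]
    have hP : ∀ p ∈ P, p ∉ Ioo a b := fun p hp h ↦
      htab ((hη' p (hsub (Ioo_subset_Icc_self h))).2 hp ▸ h)
    exact integrableOn_integrand_Ioo hT g hμ hV σ ha hb (hc a b ha hab hb hP)
      (fun τ hτ ↦ (hη' τ (hsub hτ)).1 ⟨ha.trans hτ.1, hτ.2.trans hb⟩) (hlam a b ha hab hb hP)
  have h1 := key (max 0 (t - η)) t (le_max_left _ _) ht.2
    (Icc_subset_Icc (le_max_right _ _) (by linarith)) (by simp)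
  have h2 := key t (min T (t + η)) ht.1 (min_le_left _ _)
    (Icc_subset_Icc (by linarith) (min_le_right _ _)) (by simp)
  have h3 : IntegrableOn (integrand g μ V σ T c lam) ({0, t, T} : Set ℝ) := by
    refine IntegrableOn.of_measure_zero ?_
    exact (Set.toFinite _).measure_zero _
  refine ⟨_, ?_, (h1.union h2).union h3⟩
  filter_upwards [self_mem_nhdsWithin, mem_nhdsWithin_of_mem_nhds
    (Ioo_mem_nhds (show t - η < t by linarith) (show t < t + η by linarith))] with τ hτ hτ'
  rcases lt_trichotomy τ t with h | h | h
  · rcases hτ.1.eq_or_lt with h0 | h0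
    · exact Or.inr (by simp [h0.symm])
    · exact Or.inl (Or.inl ⟨max_lt h0 hτ'.1, h⟩)
  · exact Or.inr (by simp [h])
  · rcases hτ.2.eq_or_lt with h0 | h0
    · exact Or.inr (by simp [h0])
    · exact Or.inl (Or.inr ⟨h, lt_min h0 hτ'.2⟩)

end Integrand

/-! ### Variations supported in a chart -/

section Variation

variable {n m : ℕ} {Q : Type*} [TopologicalSpace Q] [ChartedSpace (EuclideanSpace ℝ (Fin n)) Q]

open scoped Classical in
/-- The curve `c` pushed, for `t ∈ [a, b]`, by `s φ(t) w` in the chart at `x₀`. -/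
def bumpCurve (x₀ : Q) (c : ℝ → Q) (a b : ℝ) (φ : ℝ → ℝ) (w : EuclideanSpace ℝ (Fin n))
    (s t : ℝ) : Q :=
  if t ∈ Icc a b then
    (extChartAt (𝓡 n) x₀).symm (extChartAt (𝓡 n) x₀ (c t) + s • φ t • w)
  else c t

variable {T ε : ℝ} {c : ℝ → Q} {x₀ : Q} {a b : ℝ} {φ : ℝ → ℝ} {w : EuclideanSpace ℝ (Fin n)}

theorem bumpCurve_of_mem {s t : ℝ} (ht : t ∈ Icc a b) : bumpCurve x₀ c a b φ w s t =
    (extChartAt (𝓡 n) x₀).symm (extChartAt (𝓡 n) x₀ (c t) + s • φ t • w) := if_pos ht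

theorem bumpCurve_of_eq_zero (hcs : ∀ t ∈ Icc a b, c t ∈ (extChartAt (𝓡 n) x₀).source)
    {s t : ℝ} (ht : φ t = 0 ∨ s = 0) : bumpCurve x₀ c a b φ w s t = c t := by
  by_cases h : t ∈ Icc a b
  · have : s • φ t • w = 0 := by rcases ht with h | h <;> simp [h]
    rw [bumpCurve_of_mem h, this, add_zero, (extChartAt (𝓡 n) x₀).left_inv (hcs t h)]
  · exact if_neg h

theorem bumpCurve_eventuallyEq (hcs : ∀ t ∈ Icc a b, c t ∈ (extChartAt (𝓡 n) x₀).source)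
    (hφs : tsupport φ ⊆ Ioo a b) {s t : ℝ} (ht : t ∉ Ioo a b) :
    bumpCurve x₀ c a b φ w s =ᶠ[𝓝 t] c := by
  have h : (tsupport φ)ᶜ ∈ 𝓝 t :=
    (isClosed_tsupport φ).isOpen_compl.mem_nhds fun h ↦ ht (hφs h)
  filter_upwards [h] with τ hτ
  exact bumpCurve_of_eq_zero hcs (Or.inl (image_eq_zero_of_notMem_tsupport hτ))

theorem velocity_congr {c c' : ℝ → Q} {t : ℝ} (h : c =ᶠ[𝓝 t] c') :
    (velocity n T c t : EuclideanSpace ℝ (Fin n)) = velocity n T c' t := by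
  have h1 := Filter.EventuallyEq.mfderivWithin_eq (I := 𝓘(ℝ, ℝ)) (I' := 𝓡 n)
    (h.filter_mono (nhdsWithin_le_nhds (s := Icc 0 T))) h.self_of_nhds
  exact congrArg (fun L : ℝ →L[ℝ] EuclideanSpace ℝ (Fin n) ↦ L 1) h1

theorem tangent_mk_eq {p q : Q} (h : p = q) {u v : EuclideanSpace ℝ (Fin n)} (huv : u = v) :
    (⟨p, u⟩ : TangentBundle (𝓡 n) Q) = ⟨q, v⟩ := by
  subst h huv
  rfl

variable [IsManifold (𝓡 n) ∞ Q]

/-- The integrand at `t` depends only on the germ of the curve at `t`. -/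
theorem integrand_congr (g : Metric n Q) (μ : Fin m → OneForm n Q) (V : Q → ℝ) (σ : ℝ)
    (lam : Fin m → ℝ → ℝ) {c c' : ℝ → Q} {t : ℝ} (h : c =ᶠ[𝓝 t] c') :
    integrand g μ V σ T c lam t = integrand g μ V σ T c' lam t := by
  have ht := h.self_of_nhds
  have hA : ∀ c : ℝ → Q, (accel g T c t : EuclideanSpace ℝ (Fin n)) =
      derivWithin (fun τ ↦ coframe (c t) (c τ) (velocity n T c τ : EuclideanSpace ℝ (Fin n)))
        (Icc 0 T) t
      + chrL (metricCoord g (c t)) (extChartAt (𝓡 n) (c t) (c t))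
        (coframe (c t) (c t) (velocity n T c t : EuclideanSpace ℝ (Fin n)))
        (coframe (c t) (c t) (velocity n T c t : EuclideanSpace ℝ (Fin n))) :=
    fun c ↦ fromCoordAt_eq _ _
  have hd : derivWithin
      (fun τ ↦ coframe (c t) (c τ) (velocity n T c τ : EuclideanSpace ℝ (Fin n))) (Icc 0 T) t =
      derivWithin
      (fun τ ↦ coframe (c' t) (c' τ) (velocity n T c' τ : EuclideanSpace ℝ (Fin n)))
      (Icc 0 T) t := by
    have he : (fun τ ↦ coframe (c t) (c τ) (velocity n T c τ : EuclideanSpace ℝ (Fin n)))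
        =ᶠ[𝓝 t]
        (fun τ ↦ coframe (c' t) (c' τ) (velocity n T c' τ : EuclideanSpace ℝ (Fin n))) := by
      filter_upwards [h.eventuallyEq_nhds] with τ hτ
      rw [velocity_congr hτ, hτ.self_of_nhds, ht]
    exact (he.filter_mono nhdsWithin_le_nhds).derivWithin_eq he.self_of_nhds
  have hacc : (accel g T c t : EuclideanSpace ℝ (Fin n)) = accel g T c' t := by
    rw [hA c, hA c', hd, velocity_congr h, ht]
  have h0 : ∀ c : ℝ → Q, integrand g μ V σ T c lam t = (1 / 2 : ℝ) *
      (innerModel g (c t) (accel g T c t : EuclideanSpace ℝ (Fin n))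
          (accel g T c t : EuclideanSpace ℝ (Fin n))
        + σ * innerModel g (c t) (velocity n T c t : EuclideanSpace ℝ (Fin n))
          (velocity n T c t : EuclideanSpace ℝ (Fin n)) + V (c t))
      + ∑ a, lam a t * formModel (μ a) (c t) (accel g T c t : EuclideanSpace ℝ (Fin n)) :=
    fun _ ↦ rfl
  rw [h0 c, h0 c', hacc, velocity_congr h, ht]

/-- Pushing `c` in a chart by `s φ(t) w` with `φ` supported between break points is a variation. -/
theorem isVariation_bumpCurve {ξ₀ ξT : TangentBundle (𝓡 n) Q} {P : Finset ℝ}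
    {lam : Fin m → ℝ → ℝ} (hc : MemOmega T ξ₀ ξT P c) (hlam : SmoothOffFun T P lam)
    (ha : 0 ≤ a) (hab : a < b) (hb : b ≤ T) (hP : ∀ p ∈ P, p ∉ Ioo a b)
    (hcs : ∀ t ∈ Icc a b, c t ∈ (extChartAt (𝓡 n) x₀).source)
    (hφ : ContDiff ℝ ∞ φ) (hφs : tsupport φ ⊆ Ioo a b) (hε : 0 < ε)
    (hmem : ∀ s : ℝ, |s| ≤ ε → ∀ t ∈ Icc a b,
      extChartAt (𝓡 n) x₀ (c t) + s • φ t • w ∈ (extChartAt (𝓡 n) x₀).target) :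
    IsVariation T ξ₀ ξT c lam ε (P ∪ {a, b}) (bumpCurve x₀ c a b φ w) (fun _ ↦ lam) := by
  have hzero : ∀ t, t ∉ Ioo a b → φ t = 0 := fun t ht ↦
    image_eq_zero_of_notMem_tsupport fun h ↦ ht (hφs h)
  have hcab : ContMDiffOn 𝓘(ℝ, ℝ) (𝓡 n) ∞ c (Icc a b) := hc.smoothOff a b ha hab hb hP
  have hxab : ContDiffOn ℝ ∞ (fun τ ↦ extChartAt (𝓡 n) x₀ (c τ)) (Icc a b) := by
    rw [← contMDiffOn_iff_contDiffOn]
    exact (contMDiffOn_extChartAt (n := ∞)).comp hcab fun t ht ↦ by simpa using hcs t ht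
  have hjoint : ContMDiffOn 𝓘(ℝ, ℝ × ℝ) (𝓡 n) ∞
      (fun p : ℝ × ℝ ↦ bumpCurve x₀ c a b φ w p.1 p.2) (Ioo (-ε) ε ×ˢ Icc a b) := by
    have h1 : ContDiffOn ℝ ∞ (fun p : ℝ × ℝ ↦ extChartAt (𝓡 n) x₀ (c p.2) + p.1 • φ p.2 • w)
        (Ioo (-ε) ε ×ˢ Icc a b) :=
      (hxab.comp contDiffOn_snd fun p hp ↦ hp.2).add
        (contDiffOn_fst.smul ((hφ.comp_contDiffOn contDiffOn_snd).smul contDiffOn_const))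
    refine ((contMDiffOn_extChartAt_symm x₀).comp h1.contMDiffOn fun p hp ↦ ?_).congr
      fun p hp ↦ bumpCurve_of_mem hp.2
    exact hmem _ (abs_le.2 ⟨hp.1.1.le, hp.1.2.le⟩) _ hp.2
  have hsmooth : ∀ a' b' : ℝ, 0 ≤ a' → a' < b' → b' ≤ T →
      (∀ p ∈ P ∪ {a, b}, p ∉ Ioo a' b') → ContMDiffOn 𝓘(ℝ, ℝ × ℝ) (𝓡 n) ∞
        (fun p : ℝ × ℝ ↦ bumpCurve x₀ c a b φ w p.1 p.2) (Ioo (-ε) ε ×ˢ Icc a' b') := by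
    intro a' b' ha' hab' hb' hP'
    have hpa : a ∉ Ioo a' b' := hP' a (by simp)
    have hpb : b ∉ Ioo a' b' := hP' b (by simp)
    by_cases hin : a ≤ a' ∧ b' ≤ b
    · exact hjoint.mono (prod_mono_right (Icc_subset_Icc hin.1 hin.2))
    -- otherwise the strip misses the support of `φ`
    have hout : b' ≤ a ∨ b ≤ a' := by
      by_contra hcon
      push Not at hcon
      refine hin ⟨?_, ?_⟩
      · by_contra h; exact hpa ⟨not_le.1 h, hcon.1⟩
      · by_contra h; exact hpb ⟨hcon.2, not_le.1 h⟩
    refine ContMDiffOn.congr (f := fun p : ℝ × ℝ ↦ c p.2) ?_ fun p hp ↦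
      bumpCurve_of_eq_zero hcs (Or.inl (hzero _ fun h ↦ ?_))
    · exact (hc.smoothOff a' b' ha' hab' hb' fun p hp ↦ hP' p (by simp [hp])).comp
        contDiff_snd.contMDiff.contMDiffOn fun p hp ↦ hp.2
    · rcases hout with h' | h'
      · linarith [hp.2.2, h.1]
      · linarith [hp.2.1, h.2]
  have hslice : ∀ s ∈ Ioo (-ε) ε, ∀ a' b', ContMDiffOn 𝓘(ℝ, ℝ × ℝ) (𝓡 n) ∞
      (fun p : ℝ × ℝ ↦ bumpCurve x₀ c a b φ w p.1 p.2) (Ioo (-ε) ε ×ˢ Icc a' b') →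
      ContMDiffOn 𝓘(ℝ, ℝ) (𝓡 n) ∞ (bumpCurve x₀ c a b φ w s) (Icc a' b') := by
    intro s hs a' b' h
    exact h.comp (contDiff_prodMk_right s).contMDiff.contMDiffOn fun t ht ↦ ⟨hs, ht⟩
  refine ⟨hε, fun t ht ↦ bumpCurve_of_eq_zero hcs (Or.inr rfl), fun _ _ _ ↦ rfl, fun s hs ↦
    ⟨fun t ht ↦ ?_, fun a' b' ha' hab' hb' hP' ↦
      hslice s hs a' b' (hsmooth a' b' ha' hab' hb' hP'), ?_, ?_⟩, hsmooth,
      fun a' b' ha' hab' hb' hP' i ↦ ?_⟩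
  · by_cases h : t ∈ Ioo a b
    · exact (((hslice s hs a b hjoint).contMDiffAt (Icc_mem_nhds h.1 h.2)).of_le
        (by simp)).contMDiffWithinAt
    · exact (hc.contMDiffOn t ht).congr_of_eventuallyEq
        ((bumpCurve_eventuallyEq hcs hφs h).filter_mono nhdsWithin_le_nhds)
        (bumpCurve_eventuallyEq hcs hφs h).self_of_nhds
  · have h := bumpCurve_eventuallyEq (w := w) (s := s) hcs hφs (t := 0) fun h ↦ by linarith [h.1]
    rw [← hc.left]
    exact tangent_mk_eq h.self_of_nhds (velocity_congr h)
  · have h := bumpCurve_eventuallyEq (w := w) (s := s) hcs hφs (t := T) fun h ↦ by linarith [h.2]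
    rw [← hc.right]
    exact tangent_mk_eq h.self_of_nhds (velocity_congr h)
  · exact (hlam a' b' ha' hab' hb' (fun p hp ↦ hP' p (by simp [hp])) i).comp contDiffOn_snd
      fun p hp ↦ hp.2

/-- Criticality of the augmented functional, in a chart: the first variation vanishes in every
direction supported between break points. -/
theorem integral_firstVariation_eq_zero (hT : 0 < T) {g : Metric n Q} {μ : Fin m → OneForm n Q}
    (hμ : ∀ i, (μ i).IsSmooth) {V : Q → ℝ} (hV : ContMDiff (𝓡 n) 𝓘(ℝ, ℝ) ∞ V) {σ : ℝ}
    {ξ₀ ξT : TangentBundle (𝓡 n) Q} {P : Finset ℝ} {lam : Fin m → ℝ → ℝ}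
    (h : IsNormalExtremal g μ V σ T ξ₀ ξT P c lam)
    (ha : 0 ≤ a) (hab : a < b) (hb : b ≤ T) {O : Set ℝ} (hch : InChart n T c x₀ O)
    (hO : Icc a b ⊆ O) (hP : ∀ p ∈ P, p ∉ Ioo a b)
    (hφ : ContDiff ℝ ∞ φ) (hφs : tsupport φ ⊆ Ioo a b) (w : EuclideanSpace ℝ (Fin n)) :
    ∫ t in a..b, firstVariation (metricCoord g x₀) (fun i ↦ formCoord (μ i) x₀)
      (fun y ↦ V ((extChartAt (𝓡 n) x₀).symm y)) σ (extChartAt (𝓡 n) x₀ (c t))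
      (derivWithin (fun τ ↦ extChartAt (𝓡 n) x₀ (c τ)) (Icc 0 T) t)
      (derivWithin (derivWithin (fun τ ↦ extChartAt (𝓡 n) x₀ (c τ)) (Icc 0 T)) (Icc 0 T) t)
      (fun i ↦ lam i t) (φ t • w) (deriv φ t • w) (deriv (deriv φ) t • w) = 0 := by
  set x : ℝ → EuclideanSpace ℝ (Fin n) := fun τ ↦ extChartAt (𝓡 n) x₀ (c τ) with hx
  have hsub : Icc a b ⊆ Icc 0 T ∩ O := fun t ht ↦ ⟨⟨ha.trans ht.1, ht.2.trans hb⟩, hO ht⟩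
  have hcs : ∀ t ∈ Icc a b, c t ∈ (extChartAt (𝓡 n) x₀).source := fun t ht ↦ hch.mem t (hsub ht)
  have hxU : ∀ t ∈ Icc a b, x t ∈ (extChartAt (𝓡 n) x₀).target := fun t ht ↦
    hch.mapsTo (hsub ht)
  have sx : ContDiffOn ℝ ∞ x (Icc 0 T ∩ O) := hch.contDiffOn
  have sv := contDiffOn_derivWithin_inter (uniqueDiffOn_Icc hT) hch.isOpen sx
  have sz := contDiffOn_derivWithin_inter (uniqueDiffOn_Icc hT) hch.isOpen sv
  have hφ1 : ContDiff ℝ ∞ (deriv φ) := (contDiff_infty_iff_deriv.1 hφ).2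
  have hφ2 : ContDiff ℝ ∞ (deriv (deriv φ)) := (contDiff_infty_iff_deriv.1 hφ1).2
  have c0 : Continuous fun t ↦ φ t • w := hφ.continuous.smul continuous_const
  have c1 : Continuous fun t ↦ deriv φ t • w := hφ1.continuous.smul continuous_const
  have c2 : Continuous fun t ↦ deriv (deriv φ) t • w := hφ2.continuous.smul continuous_const
  obtain ⟨ε, hε, hmem⟩ := exists_pos_forall_add_smul_mem isCompact_Icc
    (isOpen_extChartAt_target (I := 𝓡 n) x₀) (sx.continuousOn.mono hsub)
    (c0.continuousOn (s := Icc a b)) hxU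
  have hvar := isVariation_bumpCurve (w := w) h.memOmega h.mult_smoothOff ha hab hb hP hcs hφ hφs
    hε hmem
  have hcrit := h.critical _ _ _ _ hvar
  have hlam := h.mult_smoothOff a b ha hab hb hP
  have hder := hasDerivAt_integral_lagrangian (σ := σ) (l := fun t i ↦ lam i t)
    (isMetricOn_metricCoord g x₀) (fun i ↦ contDiffOn_formCoord (hμ i) x₀)
    (contDiffOn_potential hV x₀) hab.le hxU (sx.continuousOn.mono hsub)
    (sv.continuousOn.mono hsub) (sz.continuousOn.mono hsub) (fun i ↦ (hlam i).continuousOn)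
    c0.continuousOn c1.continuousOn c2.continuousOn
  -- the varied curve in the chart
  have hlag : ∀ s ∈ Ioo (-ε) ε, ∀ t ∈ Ioo a b,
      integrand g μ V σ T (bumpCurve x₀ c a b φ w s) lam t =
        lagrangian (metricCoord g x₀) (fun i ↦ formCoord (μ i) x₀)
          (fun y ↦ V ((extChartAt (𝓡 n) x₀).symm y)) σ (x t + s • φ t • w)
          (derivWithin x (Icc 0 T) t + s • deriv φ t • w)
          (derivWithin (derivWithin x (Icc 0 T)) (Icc 0 T) t + s • deriv (deriv φ) t • w)
          (fun i ↦ lam i t) := by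
    intro s hs t ht
    have hs' : |s| ≤ ε := abs_le.2 ⟨hs.1.le, hs.2.le⟩
    have hS : ∀ τ ∈ Ioo a b, Icc 0 T ∈ 𝓝 τ := fun τ hτ ↦
      Icc_mem_nhds (ha.trans_lt hτ.1) (hτ.2.trans_le hb)
    have hbx : ∀ τ ∈ Ioo a b, extChartAt (𝓡 n) x₀ (bumpCurve x₀ c a b φ w s τ) =
        x τ + s • φ τ • w := fun τ hτ ↦ by
      rw [bumpCurve_of_mem (Ioo_subset_Icc_self hτ),
        (extChartAt (𝓡 n) x₀).right_inv (hmem s hs' τ (Ioo_subset_Icc_self hτ))]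
    have hchs : InChart n T (bumpCurve x₀ c a b φ w s) x₀ (Ioo a b) := by
      refine ⟨isOpen_Ioo, fun τ hτ ↦ ?_, ?_⟩
      · rw [bumpCurve_of_mem (Ioo_subset_Icc_self hτ.2)]
        exact (extChartAt (𝓡 n) x₀).map_target (hmem s hs' τ (Ioo_subset_Icc_self hτ.2))
      · refine ((hvar.memOmega s hs).smoothOff a b ha hab hb fun p hp hpab ↦ ?_).mono
          fun τ hτ ↦ Ioo_subset_Icc_self hτ.2
        rcases Finset.mem_union.1 hp with hp | hp
        · exact hP p hp hpab
        · rcases Finset.mem_insert.1 hp with rfl | hp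
          · exact lt_irrefl _ hpab.1
          · rw [Finset.mem_singleton] at hp
            exact lt_irrefl _ (hp ▸ hpab.2)
    have hev : ∀ {f f' : ℝ → EuclideanSpace ℝ (Fin n)} {y : ℝ}, y ∈ Ioo a b →
        (∀ τ ∈ Ioo a b, f τ = f' τ) → derivWithin f (Icc 0 T) y = derivWithin f' (Icc 0 T) y := by
      intro f f' y hy hff
      refine Filter.EventuallyEq.derivWithin_eq ?_ (hff y hy)
      exact mem_nhdsWithin_of_mem_nhds (Filter.mem_of_superset (isOpen_Ioo.mem_nhds hy) hff)
    have hadd : ∀ {f : ℝ → EuclideanSpace ℝ (Fin n)} {ψ : ℝ → ℝ},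
        ContDiffOn ℝ ∞ f (Icc 0 T ∩ O) → ContDiff ℝ ∞ ψ → ∀ τ ∈ Ioo a b,
        derivWithin (fun τ ↦ f τ + s • ψ τ • w) (Icc 0 T) τ =
          derivWithin f (Icc 0 T) τ + s • deriv ψ τ • w := by
      intro f ψ hf hψ τ hτ
      have hτ' := hsub (Ioo_subset_Icc_self hτ)
      have h1 := hasDerivWithinAt_of_contDiffOn_inter hch.isOpen hf hτ'
      have h2 := (((hψ.differentiable (by simp) τ).hasDerivAt.smul_const w).const_smul s
        ).hasDerivWithinAt (s := Icc 0 T)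
      exact (h1.add h2).derivWithin ((uniqueDiffOn_Icc hT) τ hτ'.1)
    have hd1 : ∀ τ ∈ Ioo a b, derivWithin
        (fun τ ↦ extChartAt (𝓡 n) x₀ (bumpCurve x₀ c a b φ w s τ)) (Icc 0 T) τ =
        derivWithin x (Icc 0 T) τ + s • deriv φ τ • w := fun τ hτ ↦
      (hev hτ hbx).trans (hadd sx hφ τ hτ)
    have hd2 := (hev ht hd1).trans (hadd sv hφ1 t ht)
    rw [hchs.integrand_eq hT g μ V σ lam (hsub (Ioo_subset_Icc_self ht) |>.1 |> fun h ↦ ⟨h, ht⟩),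
      hd2, hd1 t ht, hbx t ht]
  -- away from `[a, b]` the integrand does not change
  have hsplit : ∀ s ∈ Ioo (-ε) ε,
      augmentedFunctional g μ V σ T (bumpCurve x₀ c a b φ w s) lam =
        (∫ t in a..b, lagrangian (metricCoord g x₀) (fun i ↦ formCoord (μ i) x₀)
          (fun y ↦ V ((extChartAt (𝓡 n) x₀).symm y)) σ (x t + s • φ t • w)
          (derivWithin x (Icc 0 T) t + s • deriv φ t • w)
          (derivWithin (derivWithin x (Icc 0 T)) (Icc 0 T) t + s • deriv (deriv φ) t • w)
          (fun i ↦ lam i t))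
        + ((∫ t in (0 : ℝ)..a, integrand g μ V σ T c lam t)
          + ∫ t in b..T, integrand g μ V σ T c lam t) := by
    intro s hs
    have hΩ := hvar.memOmega s hs
    have hint := integrableOn_integrand hT g hμ hV σ hΩ.contMDiffOn.continuousOn hΩ.smoothOff
      (lam := lam) fun a' b' ha' hab' hb' hP' ↦
        h.mult_smoothOff a' b' ha' hab' hb' fun p hp ↦ hP' p (by simp [hp])
    have hii : ∀ a' b', 0 ≤ a' → a' ≤ b' → b' ≤ T → IntervalIntegrable
        (integrand g μ V σ T (bumpCurve x₀ c a b φ w s) lam) volume a' b' := by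
      intro a' b' ha' hab' hb'
      rw [intervalIntegrable_iff_integrableOn_Icc_of_le hab']
      exact hint.mono_set (Icc_subset_Icc ha' hb')
    have hJ : augmentedFunctional g μ V σ T (bumpCurve x₀ c a b φ w s) lam =
        ∫ t in (0 : ℝ)..T, integrand g μ V σ T (bumpCurve x₀ c a b φ w s) lam t := rfl
    rw [hJ, ← intervalIntegral.integral_add_adjacent_intervals
      (hii 0 a le_rfl ha (hab.le.trans hb)) (hii a T ha (hab.le.trans hb) le_rfl),
      ← intervalIntegral.integral_add_adjacent_intervals (hii a b ha hab.le hb)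
      (hii b T (ha.trans hab.le) hb le_rfl)]
    have e1 : ∫ t in (0 : ℝ)..a, integrand g μ V σ T (bumpCurve x₀ c a b φ w s) lam t =
        ∫ t in (0 : ℝ)..a, integrand g μ V σ T c lam t := by
      refine intervalIntegral.integral_congr fun t ht ↦ ?_
      rw [uIcc_of_le ha] at ht
      exact integrand_congr g μ V σ lam
        (bumpCurve_eventuallyEq hcs hφs fun h ↦ absurd h.1 (not_lt.2 ht.2))
    have e2 : ∫ t in b..T, integrand g μ V σ T (bumpCurve x₀ c a b φ w s) lam t =
        ∫ t in b..T, integrand g μ V σ T c lam t := by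
      refine intervalIntegral.integral_congr fun t ht ↦ ?_
      rw [uIcc_of_le hb] at ht
      exact integrand_congr g μ V σ lam
        (bumpCurve_eventuallyEq hcs hφs fun h ↦ absurd h.2 (not_lt.2 ht.1))
    have e3 := intervalIntegral.integral_congr_Ioo_of_le (μ := volume) hab.le
      (fun t ht ↦ hlag s hs t ht)
    rw [e1, e2, e3]
    ring
  have hev : (fun s ↦ augmentedFunctional g μ V σ T (bumpCurve x₀ c a b φ w s) lam) =ᶠ[𝓝 0]
      fun s ↦ (∫ t in a..b, lagrangian (metricCoord g x₀) (fun i ↦ formCoord (μ i) x₀)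
          (fun y ↦ V ((extChartAt (𝓡 n) x₀).symm y)) σ (x t + s • φ t • w)
          (derivWithin x (Icc 0 T) t + s • deriv φ t • w)
          (derivWithin (derivWithin x (Icc 0 T)) (Icc 0 T) t + s • deriv (deriv φ) t • w)
          (fun i ↦ lam i t))
        + ((∫ t in (0 : ℝ)..a, integrand g μ V σ T c lam t)
          + ∫ t in b..T, integrand g μ V σ T c lam t) := by
    filter_upwards [Ioo_mem_nhds (neg_lt_zero.2 hε) hε] with s hs using hsplit s hs
  exact ((hder.add_const _).congr_of_eventuallyEq hev).unique hcrit

end Variation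

/-! ### Reading off the equation -/

section Raising

variable {E : Type*} [NormedAddCommGroup E] [NormedSpace ℝ E] [FiniteDimensional ℝ E] {m : ℕ}
  {U : Set E} {G : E → E →L[ℝ] E →L[ℝ] ℝ}

/-- The field metrically dual to the 1-form `M`. -/
def raise (G : E → E →L[ℝ] E →L[ℝ] ℝ) (M : E → E →L[ℝ] ℝ) (y : E) : E := (G y).inverse (M y)

theorem apply_raise (hG : IsMetricOn U G) {y : E} (hy : y ∈ U) (M : E → E →L[ℝ] ℝ) (w : E) :
    G y (raise G M y) w = M y w := by
  rw [raise, (hG.isInvertible hy).self_apply_inverse]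

theorem contDiffAt_raise (hG : IsMetricOn U G) {M : E → E →L[ℝ] ℝ} (hM : ContDiffOn ℝ ∞ M U)
    {y : E} (hy : y ∈ U) : ContDiffAt ℝ ∞ (raise G M) y :=
  (hG.contDiffAt_inverse hy).clm_apply (hM.contDiffAt (hG.isOpen.mem_nhds hy))

/-- Raising an index commutes with covariant differentiation. -/
theorem apply_nabla_raise (hG : IsMetricOn U G) {M : E → E →L[ℝ] ℝ} (hM : ContDiffOn ℝ ∞ M U)
    {y : E} (hy : y ∈ U) (u w : E) :
    G y (fderiv ℝ (raise G M) y u + chrL G y u (raise G M y)) w =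
      fderiv ℝ M y u w - M y (chrL G y u w) := by
  have hMd := ((hM.contDiffAt (hG.isOpen.mem_nhds hy)).differentiableAt (by simp)).hasFDerivAt
  have hX := ((contDiffAt_raise hG hM hy).differentiableAt (by simp)).hasFDerivAt
  have h1 := hMd.clm_apply (hasFDerivAt_const w y)
  have h2 := ((hG.differentiableAt hy).hasFDerivAt.clm_apply hX).clm_apply (hasFDerivAt_const w y)
  have h3 := h1.congr_of_eventuallyEq (f₁ := fun z ↦ G z (raise G M z) w)
    (by filter_upwards [hG.eventually_mem hy] with z hz using apply_raise hG hz M w)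
  have h4 := congrArg (fun L : E →L[ℝ] ℝ ↦ L u) (h3.unique h2)
  simp [hG.fderiv_eq hy, apply_raise hG hy] at h4
  rw [map_add, add_apply]
  linarith

/-- The weak form of the equation, for all `w`, gives the equation itself. -/
theorem eq_zero_of_eulerLagrange (hG : IsMetricOn U G) {M : Fin m → E → E →L[ℝ] ℝ}
    (hM : ∀ i, ContDiffOn ℝ ∞ (M i) U) {V : E → ℝ} {σ : ℝ} {y v A D p r : E} (hy : y ∈ U)
    {l : Fin m → ℝ} {B : Fin m → E} (hp : p = A + ∑ i, l i • raise G (M i) y)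
    (hr : r = D + ∑ i, B i)
    (h : ∀ w, eulerLagrange G M V σ y v A l p r w = 0) :
    D + curv G y A v v - σ • A
      + ∑ i, (B i + l i • (curv G y (raise G (M i) y) v v
          + (fderiv ℝ (raise G (M i)) y A + chrL G y A (raise G (M i) y))
          - (G y).inverse (fderiv ℝ (M i) y A - (fderiv ℝ (M i) y).flip A)))
      + (1 / 2 : ℝ) • (G y).inverse (fderiv ℝ V y) = 0 := by
  refine eq_of_forall_apply_eq (hG.pos y hy) fun w ↦ ?_
  rw [map_zero, zero_apply, ← h w]
  have hc : curv G y p v v = curv G y A v v + ∑ i, l i • curv G y (raise G (M i) y) v v := by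
    let L : E →ₗ[ℝ] E :=
      { toFun := fun u ↦ curv G y u v v
        map_add' := fun a b ↦ by simp only [curv, map_add, add_apply]; abel
        map_smul' := fun a b ↦ by
          simp only [curv, map_smul, smul_apply, RingHom.id_apply]; module }
    have : L p = L A + ∑ i, l i • L (raise G (M i) y) := by
      rw [hp, map_add, map_sum]
      simp only [map_smul]
    exact this
  rw [eulerLagrange, hc, hr]
  have hN := fun i ↦ apply_nabla_raise hG (hM i) hy A w
  simp only [map_add, map_sub, map_smul, map_sum, add_apply, sub_apply, smul_apply, smul_eq_mul,
    sum_apply, Finset.sum_add_distrib, mul_add, mul_sub,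
    (hG.isInvertible hy).self_apply_inverse, ContinuousLinearMap.flip_apply,
    Finset.sum_sub_distrib] at hN ⊢
  have hs : ∑ i, l i * G y (fderiv ℝ (raise G (M i)) y A) w
      + ∑ i, l i * G y (chrL G y A (raise G (M i) y)) w
      = ∑ i, l i * fderiv ℝ (M i) y A w - ∑ i, l i * M i y (chrL G y w A) := by
    rw [← Finset.sum_add_distrib, ← Finset.sum_sub_distrib]
    refine Finset.sum_congr rfl fun i _ ↦ ?_
    rw [← mul_add, hN i, hG.chrL_symm hy A w, mul_sub]
  linarith

end Raising

section Manifold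

variable {n m : ℕ} {Q : Type*} [TopologicalSpace Q] [ChartedSpace (EuclideanSpace ℝ (Fin n)) Q]
  [IsManifold (𝓡 n) ∞ Q]

theorem dualField_eq (g : Metric n Q) (μ : OneForm n Q) {x₀ q : Q}
    (hq : q ∈ (extChartAt (𝓡 n) x₀).source) :
    dualField g μ q = frame x₀ q
      (raise (metricCoord g x₀) (formCoord μ x₀) (extChartAt (𝓡 n) x₀ q)) := by
  have h : (formModel μ q).comp (frame x₀ q) = formCoord μ x₀ (extChartAt (𝓡 n) x₀ q) := by
    ext1 u
    exact (formCoord_extChartAt μ hq u).symm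
  rw [raise, ← h]
  exact sharp_eq g hq (formModel μ q)

theorem sharp_self (g : Metric n Q) (q : Q) (α : EuclideanSpace ℝ (Fin n) →L[ℝ] ℝ) :
    sharp g q α = (metricCoord g q (extChartAt (𝓡 n) q q)).inverse α := by
  rw [sharp_eq g (mem_extChartAt_source (I := 𝓡 n) q), frame_self]
  rfl

theorem curvature_eq (g : Metric n Q) (q : Q) (u v w : EuclideanSpace ℝ (Fin n)) :
    curvature g q u v w = curv (metricCoord g q) (extChartAt (𝓡 n) q q) u v w := by
  have hd := (isMetricOn_metricCoord g q).differentiableAt_chrL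
    (mem_extChartAt_target (I := 𝓡 n) q)
  have h : curvature g q u v w =
      fderiv ℝ (fun y ↦ chrL (metricCoord g q) y (coframe q q v) (coframe q q w))
        (extChartAt (𝓡 n) q q) (coframe q q u)
      - fderiv ℝ (fun y ↦ chrL (metricCoord g q) y (coframe q q u) (coframe q q w))
        (extChartAt (𝓡 n) q q) (coframe q q v)
      + chrL (metricCoord g q) (extChartAt (𝓡 n) q q) (coframe q q u)
        (chrL (metricCoord g q) (extChartAt (𝓡 n) q q) (coframe q q v) (coframe q q w))
      - chrL (metricCoord g q) (extChartAt (𝓡 n) q q) (coframe q q v)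
        (chrL (metricCoord g q) (extChartAt (𝓡 n) q q) (coframe q q u) (coframe q q w)) :=
    fromCoordAt_eq _ _
  rw [h, fderiv_apply₂ hd, fderiv_apply₂ hd, coframe_self]
  rfl

theorem nabla_dualField_eq (g : Metric n Q) (μ : OneForm n Q) (q : Q)
    (u : EuclideanSpace ℝ (Fin n)) :
    nabla g (dualField g μ) q u =
      fderiv ℝ (raise (metricCoord g q) (formCoord μ q)) (extChartAt (𝓡 n) q q) u
        + chrL (metricCoord g q) (extChartAt (𝓡 n) q q) u
          (raise (metricCoord g q) (formCoord μ q) (extChartAt (𝓡 n) q q)) := by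
  have hf : ∀ y ∈ (extChartAt (𝓡 n) q).target, fieldCoord (dualField g μ) q y =
      raise (metricCoord g q) (formCoord μ q) y := fun y hy ↦ by
    have hs := (extChartAt (𝓡 n) q).map_target hy
    have h1 : fieldCoord (dualField g μ) q y = coframe q ((extChartAt (𝓡 n) q).symm y)
      (dualField g μ ((extChartAt (𝓡 n) q).symm y) : EuclideanSpace ℝ (Fin n)) := rfl
    rw [h1, dualField_eq g μ hs, coframe_frame hs, (extChartAt (𝓡 n) q).right_inv hy]
  have hy := mem_extChartAt_target (I := 𝓡 n) q
  have he : fieldCoord (dualField g μ) q =ᶠ[𝓝 (extChartAt (𝓡 n) q q)]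
      raise (metricCoord g q) (formCoord μ q) := by
    filter_upwards [(isOpen_extChartAt_target (I := 𝓡 n) q).mem_nhds hy] with y hy using hf y hy
  have h : nabla g (dualField g μ) q u =
      fderiv ℝ (fieldCoord (dualField g μ) q) (extChartAt (𝓡 n) q q) (coframe q q u)
        + chrL (metricCoord g q) (extChartAt (𝓡 n) q q) (coframe q q u)
          (fieldCoord (dualField g μ) q (extChartAt (𝓡 n) q q)) := fromCoordAt_eq _ _
  rw [h, he.fderiv_eq, hf _ hy, coframe_self]
  rfl

theorem opS_eq (g : Metric n Q) (μ : OneForm n Q) (q : Q) (u : EuclideanSpace ℝ (Fin n)) :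
    opS g μ q u = (metricCoord g q (extChartAt (𝓡 n) q q)).inverse
      (fderiv ℝ (formCoord μ q) (extChartAt (𝓡 n) q q) u
        - (fderiv ℝ (formCoord μ q) (extChartAt (𝓡 n) q q)).flip u) := by
  have h : (dForm μ q u : EuclideanSpace ℝ (Fin n) →L[ℝ] ℝ) =
      (fderiv ℝ (formCoord μ q) (extChartAt (𝓡 n) q q) (coframe q q u)
        - (fderiv ℝ (formCoord μ q) (extChartAt (𝓡 n) q q)).flip (coframe q q u)).comp
        (coframe q q) := rfl
  rw [coframe_self] at h
  have h2 : opS g μ q u = (metricCoord g q (extChartAt (𝓡 n) q q)).inverse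
      (dForm μ q u : EuclideanSpace ℝ (Fin n) →L[ℝ] ℝ) := sharp_self g q (dForm μ q u)
  rw [h2, h]
  rfl

theorem grad_eq (g : Metric n Q) {V : Q → ℝ} (hV : ContMDiff (𝓡 n) 𝓘(ℝ, ℝ) ∞ V) (q : Q) :
    grad g V q = (metricCoord g q (extChartAt (𝓡 n) q q)).inverse
      (fderiv ℝ (fun y ↦ V ((extChartAt (𝓡 n) q).symm y)) (extChartAt (𝓡 n) q q)) := by
  have hy := mem_extChartAt_target (I := 𝓡 n) q
  have hl : (extChartAt (𝓡 n) q).symm (extChartAt (𝓡 n) q q) = q := extChartAt_to_inv q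
  have h1 : ContMDiffAt 𝓘(ℝ, EuclideanSpace ℝ (Fin n)) (𝓡 n) ∞ (extChartAt (𝓡 n) q).symm
      (extChartAt (𝓡 n) q q) := (contMDiffOn_extChartAt_symm q).contMDiffAt
        ((isOpen_extChartAt_target (I := 𝓡 n) q).mem_nhds hy)
  have h2 := mfderiv_comp (extChartAt (𝓡 n) q q)
    ((hV.contMDiffAt (x := (extChartAt (𝓡 n) q).symm (extChartAt (𝓡 n) q q))).mdifferentiableAt
      (by simp)) (h1.mdifferentiableAt (by simp))
  rw [mfderiv_eq_fderiv] at h2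
  have h3 : fderiv ℝ (fun y ↦ V ((extChartAt (𝓡 n) q).symm y)) (extChartAt (𝓡 n) q q) =
      ContinuousLinearMap.comp (mfderiv (𝓡 n) 𝓘(ℝ, ℝ) V
        ((extChartAt (𝓡 n) q).symm (extChartAt (𝓡 n) q q)) : EuclideanSpace ℝ (Fin n) →L[ℝ] ℝ)
        (frame q q) := h2
  rw [frame_self, hl] at h3
  rw [h3]
  exact sharp_self g q _

/-- The left-hand side of the equation of normal extremals as a function of its ingredients. -/
def extremalExpression {E : Type*} [NormedAddCommGroup E] [NormedSpace ℝ E] (σ : ℝ)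
    (l l₁ l₂ : Fin m → ℝ) (D RA A : E) (Y Y₁ Y₂ RY N S : Fin m → E) (grV : E) : E :=
  D + RA - σ • A + ∑ i, (l₂ i • Y i + (2 * l₁ i) • Y₁ i + l i • Y₂ i
    + l i • (RY i + N i - S i)) + (1 / 2 : ℝ) • grV

end Manifold

end ConstrainedAcceleration

end

set_option maxSynthPendingDepth 3
set_option synthInstance.maxHeartbeats 200000

open ConstrainedAcceleration in
theorem theorem2 {n m : ℕ} {Q : Type*} [TopologicalSpace Q]
    [ChartedSpace (EuclideanSpace ℝ (Fin n)) Q] [IsManifold (𝓡 n) ∞ Q]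
    (g : Metric n Q) (μ : Fin m → OneForm n Q) (hμ : ∀ a, (μ a).IsSmooth)
    (V : Q → ℝ) (hV : ContMDiff (𝓡 n) 𝓘(ℝ, ℝ) ∞ V) (σ : ℝ) (hσ : 0 ≤ σ) (T : ℝ) (hT : 0 < T)
    (ξ₀ ξT : TangentBundle (𝓡 n) Q) (P : Finset ℝ) (c : ℝ → Q) (lam : Fin m → ℝ → ℝ)
    (h : IsNormalExtremal g μ V σ T ξ₀ ξT P c lam) :
    ∀ t ∈ Icc 0 T, t ∉ P →
      covD g T c (covD g T c (accel g T c)) t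
        + curvature g (c t) (accel g T c t) (velocity n T c t) (velocity n T c t)
        - σ • accel g T c t
        + ∑ a, (iteratedDerivWithin 2 (lam a) (Icc 0 T) t • dualField g (μ a) (c t)
            + (2 * derivWithin (lam a) (Icc 0 T) t)
                • covD g T c (fun τ ↦ dualField g (μ a) (c τ)) t
            + lam a t • covD g T c (covD g T c (fun τ ↦ dualField g (μ a) (c τ))) t
            + lam a t •
                (curvature g (c t) (dualField g (μ a) (c t)) (velocity n T c t) (velocity n T c t)
                  + nabla g (dualField g (μ a)) (c t) (accel g T c t)
                  - opS g (μ a) (c t) (accel g T c t)))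
        + (1 / 2 : ℝ) • grad g V (c t) = 0 := by
  intro t ht htP
  set x₀ := c t
  obtain ⟨η, hη, hη'⟩ := exists_Icc_subset_chart (n := n) h.memOmega.contMDiffOn.continuousOn P ht
  set O := Ioo (t - η) (t + η)
  have htO : t ∈ O := ⟨by linarith, by linarith⟩
  have hPO : ∀ p ∈ P, p ∉ O := fun p hp hpO ↦
    htP ((hη' p (Ioo_subset_Icc_self hpO)).2 hp ▸ hp)
  have hch : InChart n T c x₀ O := by
    refine ⟨isOpen_Ioo, fun τ hτ ↦ (hη' τ (Ioo_subset_Icc_self hτ.2)).1 hτ.1, ?_⟩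
    refine (h.memOmega.smoothOff (max 0 (t - η)) (min T (t + η)) (le_max_left _ _) ?_
      (min_le_left _ _) fun p hp hpI ↦ hPO p hp
        ⟨(le_max_right _ _).trans_lt hpI.1, hpI.2.trans_le (min_le_right _ _)⟩).mono
      fun τ hτ ↦ ⟨max_le hτ.1.1 hτ.2.1.le, le_min hτ.1.2 hτ.2.2.le⟩
    exact max_lt (lt_min hT (by linarith [ht.1])) (lt_min (by linarith [ht.2]) (by linarith))
  have hlam : ∀ i, ContDiffOn ℝ ∞ (lam i) (Icc 0 T ∩ O) := fun i ↦ by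
    refine (h.mult_smoothOff (max 0 (t - η)) (min T (t + η)) (le_max_left _ _) ?_
      (min_le_left _ _) (fun p hp hpI ↦ hPO p hp
        ⟨(le_max_right _ _).trans_lt hpI.1, hpI.2.trans_le (min_le_right _ _)⟩) i).mono
      fun τ hτ ↦ ⟨max_le hτ.1.1 hτ.2.1.le, le_min hτ.1.2 hτ.2.2.le⟩
    exact max_lt (lt_min hT (by linarith [ht.1])) (lt_min (by linarith [ht.2]) (by linarith))
  -- the closed interval `[a, b]` is a neighbourhood of `t` in `[0, T]`, one-sided at an end point
  obtain ⟨a, ha0, hat, haO⟩ : ∃ a, 0 ≤ a ∧ a ≤ t ∧ t - η < a ∧ (a < t ∨ t = 0) := by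
    refine ⟨max 0 (t - η / 2), le_max_left _ _, max_le ht.1 (by linarith),
      lt_max_of_lt_right (by linarith), ?_⟩
    rcases ht.1.eq_or_lt with h0 | h0
    · exact Or.inr h0.symm
    · exact Or.inl (max_lt h0 (by linarith))
  obtain ⟨b, hbT, htb, hbO⟩ : ∃ b, b ≤ T ∧ t ≤ b ∧ b < t + η ∧ (t < b ∨ t = T) := by
    refine ⟨min T (t + η / 2), min_le_left _ _, le_min ht.2 (by linarith),
      min_lt_of_right_lt (by linarith), ?_⟩
    rcases ht.2.eq_or_lt with h0 | h0
    · exact Or.inr h0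
    · exact Or.inl (lt_min h0 (by linarith))
  have hab : a < b := by
    rcases haO.2 with h1 | h1
    · linarith
    · rcases hbO.2 with h2 | h2 <;> linarith
  have habO : Icc a b ⊆ O := fun τ hτ ↦ ⟨haO.1.trans_le hτ.1, hτ.2.trans_lt hbO.1⟩
  have hsub : Icc a b ⊆ Icc 0 T ∩ O := fun τ hτ ↦
    ⟨⟨ha0.trans hτ.1, hτ.2.trans hbT⟩, habO hτ⟩
  have hsub' : Ioo a b ⊆ Icc 0 T ∩ O := Ioo_subset_Icc_self.trans hsub
  have hPab : ∀ p ∈ P, p ∉ Ioo a b := fun p hp hpI ↦ hPO p hp (hsub' hpI).2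
  have htt : t ∈ Icc 0 T ∩ O := ⟨ht, htO⟩
  -- the data in the chart at `c t`
  set S := Icc 0 T
  have hu : UniqueDiffOn ℝ S := uniqueDiffOn_Icc hT
  set G := metricCoord g x₀
  have hG : IsMetricOn (extChartAt (𝓡 n) x₀).target G := isMetricOn_metricCoord g x₀
  set M : Fin m → EuclideanSpace ℝ (Fin n) → EuclideanSpace ℝ (Fin n) →L[ℝ] ℝ :=
    fun i ↦ formCoord (μ i) x₀
  have hM : ∀ i, ContDiffOn ℝ ∞ (M i) (extChartAt (𝓡 n) x₀).target := fun i ↦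
    contDiffOn_formCoord (hμ i) x₀
  set x : ℝ → EuclideanSpace ℝ (Fin n) := fun τ ↦ extChartAt (𝓡 n) x₀ (c τ)
  set v := derivWithin x S
  set A := covDeriv G S x v
  let Y : Fin m → ℝ → EuclideanSpace ℝ (Fin n) := fun i τ ↦ raise G (M i) (x τ)
  have sx : ContDiffOn ℝ ∞ x (S ∩ O) := hch.contDiffOn
  have sv : ContDiffOn ℝ ∞ v (S ∩ O) := hch.contDiffOn_deriv hT
  have sz : ContDiffOn ℝ ∞ (derivWithin v S) (S ∩ O) :=
    contDiffOn_derivWithin_inter hu hch.isOpen sv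
  have sA : ContDiffOn ℝ ∞ A (S ∩ O) := hch.contDiffOn_covDeriv hT g sv
  have sY : ∀ i, ContDiffOn ℝ ∞ (Y i) (S ∩ O) := fun i τ hτ ↦
    ContDiffAt.comp_contDiffWithinAt (g := raise G (M i)) (f := x) τ
      (contDiffAt_raise hG (hM i) (hch.mapsTo hτ)) (sx τ hτ)
  let p : ℝ → EuclideanSpace ℝ (Fin n) := fun τ ↦ A τ + ∑ i, lam i τ • Y i τ
  have sp : ContDiffOn ℝ ∞ p (S ∩ O) :=
    sA.add (ContDiffOn.sum fun i _ ↦ (hlam i).smul (sY i))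
  have sq := hch.contDiffOn_covDeriv hT g sp
  have sr := hch.contDiffOn_covDeriv hT g sq
  have sq' := contDiffOn_derivWithin_inter hu hch.isOpen sq
  have hd : ∀ {f : ℝ → EuclideanSpace ℝ (Fin n)}, ContDiffOn ℝ ∞ f (S ∩ O) →
      ∀ τ ∈ Ioo a b, HasDerivAt f (derivWithin f S τ) τ := fun hf τ hτ ↦
    (hasDerivWithinAt_of_contDiffOn_inter hch.isOpen hf (hsub' hτ)).hasDerivAt
      (Icc_mem_nhds (ha0.trans_lt hτ.1) (hτ.2.trans_le hbT))
  have hEL : ∀ w, eulerLagrange G M (fun y ↦ V ((extChartAt (𝓡 n) x₀).symm y)) σ (x t) (v t) (A t)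
      (fun i ↦ lam i t) (p t) (covDeriv G S x (covDeriv G S x p) t) w = 0 := by
    intro w
    have h0 := eulerLagrange_eq_zero (σ := σ) (X := Y) (p := p) (q := covDeriv G S x p)
      (l := fun τ i ↦ lam i τ) hG hM (contDiffOn_potential hV x₀) hab
      (fun τ hτ ↦ hch.mapsTo (hsub hτ))
      (fun τ hτ i w ↦ apply_raise hG (hch.mapsTo (hsub' hτ)) (M i) w)
      (sx.continuousOn.mono hsub) (sv.continuousOn.mono hsub) (sz.continuousOn.mono hsub)
      (sp.continuousOn.mono hsub) (sq.continuousOn.mono hsub) (sq'.continuousOn.mono hsub)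
      (fun i ↦ (hlam i).continuousOn.mono hsub) (hd sx) (hd sv) (hd sp) (hd sq)
      (fun τ _ ↦ rfl) (fun τ _ ↦ rfl)
      (fun φ hφ _ hφs w ↦ integral_firstVariation_eq_zero hT hμ hV h ha0 hab hbT hch habO hPab
        hφ hφs w) w
    have hc := continuousOn_eulerLagrange (σ := σ) (l := fun τ i ↦ lam i τ) hG hM
      (contDiffOn_potential hV x₀) (fun τ hτ ↦ hch.mapsTo (hsub hτ)) (sx.continuousOn.mono hsub)
      (sv.continuousOn.mono hsub) (sA.continuousOn.mono hsub)
      (fun i ↦ (hlam i).continuousOn.mono hsub) (sp.continuousOn.mono hsub)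
      (sr.continuousOn.mono hsub) (continuousOn_const (c := w))
    exact Set.EqOn.of_subset_closure (g := fun _ ↦ (0 : ℝ)) (fun τ hτ ↦ h0 τ hτ) hc
      continuousOn_const Ioo_subset_Icc_self (closure_Ioo hab.ne).ge ⟨hat, htb⟩
  have hfin := eq_zero_of_eulerLagrange hG hM (hch.mapsTo htt) rfl
    (covDeriv_covDeriv_add_sum_smul hG hu hch.isOpen sx hch.mapsTo sA hlam sY htt) hEL
  -- translate back to the manifold
  have e : ∀ u, frame (n := n) (c t) (c t) u = u := fun u ↦ by rw [frame_self]; rfl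
  have hvel : (velocity n T c t : EuclideanSpace ℝ (Fin n)) = v t :=
    (hch.velocity_eq hT t htt).trans (e _)
  have hacc : (accel g T c t : EuclideanSpace ℝ (Fin n)) = A t :=
    (hch.accel_eq hT g t htt).trans (e _)
  have h4 : (covD g T c (covD g T c (accel g T c)) t : EuclideanSpace ℝ (Fin n)) =
      covDeriv G S x (covDeriv G S x A) t :=
    (hch.covD_eq hT g (hch.covD_eq hT g (hch.accel_eq hT g) sA)
      (hch.contDiffOn_covDeriv hT g sA) t htt).trans (e _)
  have hYτ : ∀ i, ∀ τ ∈ S ∩ O, dualField g (μ i) (c τ) = frame x₀ (c τ) (Y i τ) := fun i τ hτ ↦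
    dualField_eq g (μ i) (hch.mem τ hτ)
  have hY0 : (fun i ↦ (dualField g (μ i) (c t) : EuclideanSpace ℝ (Fin n))) = fun i ↦ Y i t :=
    funext fun i ↦ (hYτ i t htt).trans (e _)
  have hY1 : (fun i ↦ (covD g T c (fun τ ↦ dualField g (μ i) (c τ)) t :
      EuclideanSpace ℝ (Fin n))) = fun i ↦ covDeriv G S x (Y i) t :=
    funext fun i ↦ (hch.covD_eq hT g (hYτ i) (sY i) t htt).trans (e _)
  have hY2 : (fun i ↦ (covD g T c (covD g T c (fun τ ↦ dualField g (μ i) (c τ))) t :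
      EuclideanSpace ℝ (Fin n))) = fun i ↦ covDeriv G S x (covDeriv G S x (Y i)) t :=
    funext fun i ↦ (hch.covD_eq hT g (hch.covD_eq hT g (hYτ i) (sY i))
      (hch.contDiffOn_covDeriv hT g (sY i)) t htt).trans (e _)
  have hRA : (curvature g (c t) (accel g T c t) (velocity n T c t) (velocity n T c t) :
      EuclideanSpace ℝ (Fin n)) = curv G (x t) (A t) (v t) (v t) := by
    refine (curvature_eq g (c t) _ _ _).trans ?_
    rw [hacc, hvel]
  have hRY : (fun i ↦ (curvature g (c t) (dualField g (μ i) (c t)) (velocity n T c t)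
      (velocity n T c t) : EuclideanSpace ℝ (Fin n))) = fun i ↦ curv G (x t) (Y i t) (v t) (v t) :=
    funext fun i ↦ by
      refine (curvature_eq g (c t) _ _ _).trans ?_
      rw [hvel, congrFun hY0 i]
  have hN : (fun i ↦ (nabla g (dualField g (μ i)) (c t) (accel g T c t) :
      EuclideanSpace ℝ (Fin n))) = fun i ↦
        fderiv ℝ (raise G (M i)) (x t) (A t) + chrL G (x t) (A t) (Y i t) :=
    funext fun i ↦ by
      refine (nabla_dualField_eq g (μ i) (c t) _).trans ?_
      rw [hacc]
  have hSμ : (fun i ↦ (opS g (μ i) (c t) (accel g T c t) : EuclideanSpace ℝ (Fin n))) = fun i ↦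
        (G (x t)).inverse (fderiv ℝ (M i) (x t) (A t) - (fderiv ℝ (M i) (x t)).flip (A t)) :=
    funext fun i ↦ by
      refine (opS_eq g (μ i) (c t) _).trans ?_
      rw [hacc]
  have hl2 : (fun i ↦ iteratedDerivWithin 2 (lam i) S t) =
      fun i ↦ derivWithin (derivWithin (lam i) S) S t := funext fun i ↦ by
    rw [iteratedDerivWithin_succ, iteratedDerivWithin_one]
  refine Eq.trans (b := extremalExpression (E := EuclideanSpace ℝ (Fin n)) σ (fun i ↦ lam i t)
    (fun i ↦ derivWithin (lam i) S t) (fun i ↦ iteratedDerivWithin 2 (lam i) S t)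
    (covD g T c (covD g T c (accel g T c)) t : EuclideanSpace ℝ (Fin n))
    (curvature g (c t) (accel g T c t) (velocity n T c t) (velocity n T c t) :
      EuclideanSpace ℝ (Fin n))
    (accel g T c t : EuclideanSpace ℝ (Fin n))
    (fun i ↦ (dualField g (μ i) (c t) : EuclideanSpace ℝ (Fin n)))
    (fun i ↦ (covD g T c (fun τ ↦ dualField g (μ i) (c τ)) t : EuclideanSpace ℝ (Fin n)))
    (fun i ↦ (covD g T c (covD g T c (fun τ ↦ dualField g (μ i) (c τ))) t :
      EuclideanSpace ℝ (Fin n)))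
    (fun i ↦ (curvature g (c t) (dualField g (μ i) (c t)) (velocity n T c t)
      (velocity n T c t) : EuclideanSpace ℝ (Fin n)))
    (fun i ↦ (nabla g (dualField g (μ i)) (c t) (accel g T c t) : EuclideanSpace ℝ (Fin n)))
    (fun i ↦ (opS g (μ i) (c t) (accel g T c t) : EuclideanSpace ℝ (Fin n)))
    (grad g V (c t) : EuclideanSpace ℝ (Fin n))) rfl ?_
  rw [hRA, hRY, hN, hSμ, h4, hY1, hY2, hY0, hacc, hl2, grad_eq g hV (c t)]
  exact hfin
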